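/- Let $d\in\{2,3\}$, let $\Omega\subset\mathbb R^d$ be a bounded domain of class $C^2$ with boundary $\Gamma$, outward unit normal $\mathbf n$ and surface measure $\mathrm d\Gamma$, and let $K\in[0,\infty)$, $\alpha\in[-1,1]$ and $\Theta_\Omega,\Theta_\Gamma>0$. Let $F_1,G_1\in C([-1,1])\cap C^2(-1,1)$ satisfy $F_1(0)=G_1(0)=0$, $F_1'(0)=G_1'(0)=0$, $$\lim_{s\searrow-1}F_1'(s)=\lim_{s\searrow-1}G_1'(s)=-\infty,\qquad \lim_{s\nearrow1}F_1'(s)=\lim_{s\nearrow1}G_1'(s)=+\infty,$$ $$F_1''(s)\ge\Theta_\Omega,\qquad G_1''(s)\ge\Theta_\Gamma\qquad\text{for all }s\in(-1,1),$$ and suppose that there are $\kappa_1,\kappa_2>0$ with $|F_1'(\alpha s)|\le\kappa_1|G_1'(s)|+\kappa_2$ for all $s\in(-1,1)$. For $(f,g)\in L^2(\Omega)\times L^2(\Gamma)$ consider the system $$-\Delta u+F_1'(u)=f\ \text{ in }\Omega,\qquad -\Delta_\Gamma v+G_1'(v)+\alpha\,\partial_{\mathbf n}u=g\ \text{ on }\Gamma,\qquad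 K\,\partial_{\mathbf n}u=\alpha v-u\ \text{ on }\Gamma,\tag{$*$}$$ where $\Delta_\Gamma$ is the Laplace–Beltrami operator on $\Gamma$. A solution of $(*)$ is a pair $(u,v)\in H^2(\Omega)\times H^2(\Gamma)$ with $|u|<1$ a.e. in $\Omega$, $|v|<1$ a.e. on $\Gamma$ and $(F_1'(u),G_1'(v))\in L^2(\Omega)\times L^2(\Gamma)$ such that the three equations hold almost everywhere, with $u$ and $\partial_{\mathbf n}u=\nabla u\cdot\mathbf n$ on $\Gamma$ understood in the sense of traces (for $K=0$ the third equation is the condition $u=\alpha v$ a.e. on $\Gamma$). Then there is a constant $C>0$ depending only on $\Omega,K,\alpha,\Theta_\Omega,\Theta_\Gamma$ such that, for all $(f_1,g_1),(f_2,g_2)\in L^2(\Omega)\times L^2(\Gamma)$ and all solutions $(u_1,v_1)$, $(u_2,v_2)$ of $(*)$ with right-hand sides $(f_1,g_1)$ and $(f_2,g_2)$, respectively, $$\|(u_1-u_2,v_1-v_2)\|_{H^1(\Omega)\times H^1(\Gamma)}\le C\,\|(f_1-f_2,g_1-g_2)\|_{L^2(\Omega)\times L^2(\Gamma)}.$$ In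 particular, for each $(f,g)\in L^2(\Omega)\times L^2(\Gamma)$ the solution of $(*)$ is unique: any two solutions agree almost everywhere in $\Omega$ and on $\Gamma$, respectively. -/

import Mathlib

open MeasureTheory Filter Set
open scoped Topology ContDiff

noncomputable section

namespace BulkSurface

/-- Euclidean space `ℝ^d`. -/
abbrev E (d : ℕ) : Type := EuclideanSpace ℝ (Fin d)

variable {d : ℕ}

/-! ### The domain, its boundary, surface measure and outward unit normal -/

/-- A bounded domain of class `C²`: a bounded, open, connected, nonempty set which, near each of its
boundary points `p`, lies strictly below the graph of a `C²` function. The graph is taken over the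
hyperplane orthogonal to some unit vector `ν`; a function on that hyperplane is the same as a
function `γ` on the whole space that is constant in the direction `ν`. -/
structure IsBoundedC2Domain (Ω : Set (E d)) : Prop where
  isOpen : IsOpen Ω
  isConnected : IsConnected Ω
  isBounded : Bornology.IsBounded Ω
  boundary : ∀ p ∈ frontier Ω, ∃ r > 0, ∃ ν : E d, ∃ γ : E d → ℝ,
    ‖ν‖ = 1 ∧ ContDiff ℝ 2 γ ∧ (∀ x (t : ℝ), γ (x + t • ν) = γ x) ∧
      Ω ∩ Metric.ball p r = {x ∈ Metric.ball p r | inner ℝ ν x < γ x}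

/-- Lebesgue measure on `Ω`. -/
def bulkMeasure (Ω : Set (E d)) : Measure (E d) := volume.restrict Ω

/-- Surface measure on the boundary `Γ` of `Ω`: the `(d-1)`-dimensional Hausdorff measure (normalised
so as to agree with Lebesgue measure on `ℝ^(d-1)`), restricted to `Γ`. -/
def surfaceMeasure (Ω : Set (E d)) : Measure (E d) :=
  (Measure.euclideanHausdorffMeasure (d - 1)).restrict (frontier Ω)

/-- `n` is the outward unit normal to `Ω` at the boundary point `x`: near `x`, the set `Ω` is
`{ρ < 0}` for a `C¹` function `ρ` with `ρ x = 0` whose gradient at `x` is a positive multiple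
of the unit vector `n`. There is at most one such vector. -/
def IsOutwardUnitNormal (Ω : Set (E d)) (x n : E d) : Prop :=
  ‖n‖ = 1 ∧ ∃ (ρ : E d → ℝ) (c : ℝ), 0 < c ∧ ContDiffAt ℝ 1 ρ x ∧ ρ x = 0 ∧
    HasGradientAt ρ (c • n) x ∧ ∀ᶠ y in 𝓝 x, (y ∈ Ω ↔ ρ y < 0)

open Classical in
/-- The outward unit normal field of `Ω` (zero where there is none). -/
def outwardNormal (Ω : Set (E d)) (x : E d) : E d :=
  if h : ∃ n, IsOutwardUnitNormal Ω x n then h.choose else 0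

/-! ### Sobolev spaces in the bulk -/

/-- Smooth compactly supported functions on `ℝ^d`. -/
def IsTest (φ : E d → ℝ) : Prop := ContDiff ℝ ∞ φ ∧ HasCompactSupport φ

/-- `Du` is the weak (distributional) gradient of `u` in `Ω`. -/
def HasWeakGradient (Ω : Set (E d)) (u : E d → ℝ) (Du : E d → E d) : Prop :=
  ∀ φ : E d → ℝ, IsTest φ → tsupport φ ⊆ Ω →
    ∫ x, u x • gradient φ x ∂bulkMeasure Ω = - ∫ x, φ x • Du x ∂bulkMeasure Ω

/-- An element of `H²(Ω)`, together with its weak derivatives: the weak gradient `grad` and, for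
each `i`, the weak gradient `hess i` of the `i`-th partial derivative. -/
structure BulkH2 (Ω : Set (E d)) where
  val : E d → ℝ
  grad : E d → E d
  hess : Fin d → E d → E d
  memLp_val : MemLp val 2 (bulkMeasure Ω)
  memLp_grad : MemLp grad 2 (bulkMeasure Ω)
  memLp_hess : ∀ i, MemLp (hess i) 2 (bulkMeasure Ω)
  weak_grad : HasWeakGradient Ω val grad
  weak_hess : ∀ i, HasWeakGradient Ω (fun x => grad x i) (hess i)

/-- The Laplacian `Δu = ∑ᵢ ∂ᵢ∂ᵢu` of an `H²(Ω)` function. -/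
def BulkH2.laplacian {Ω : Set (E d)} (u : BulkH2 Ω) (x : E d) : ℝ := ∑ i, u.hess i x i

/-- `uΓ ∈ L²(Γ)` is the trace on `Γ` of the function `u ∈ H¹(Ω)` with weak gradient `Du`. The trace
operator is the continuous extension from `H¹(Ω)` to `L²(Γ)` of the restriction of smooth
functions: some smooth functions converge to `u` in `H¹(Ω)` and their restrictions to `Γ`
converge to `uΓ` in `L²(Γ)`. -/
def HasTrace (Ω : Set (E d)) (u : E d → ℝ) (Du : E d → E d) (uΓ : E d → ℝ) : Prop :=
  MemLp uΓ 2 (surfaceMeasure Ω) ∧ ∃ φ : ℕ → E d → ℝ, (∀ k, IsTest (φ k)) ∧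
    Tendsto (fun k => eLpNorm (fun x => φ k x - u x) 2 (bulkMeasure Ω)) atTop (𝓝 0) ∧
    Tendsto (fun k => eLpNorm (fun x => gradient (φ k) x - Du x) 2 (bulkMeasure Ω)) atTop (𝓝 0) ∧
    Tendsto (fun k => eLpNorm (fun x => φ k x - uΓ x) 2 (surfaceMeasure Ω)) atTop (𝓝 0)

/-! ### Sobolev spaces on the boundary -/

/-- The tangential gradient `∇_Γ φ = ∇φ - (∇φ · n) n` on `Γ` of a smooth function on `ℝ^d`. -/
def tangentialGradient (Ω : Set (E d)) (φ : E d → ℝ) (x : E d) : E d :=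
  gradient φ x - (inner ℝ (gradient φ x) (outwardNormal Ω x) : ℝ) • outwardNormal Ω x

/-- `v` belongs to `H¹(Γ)` with surface gradient `Dv`, where `H¹(Γ)` is the closure of the smooth
functions: some smooth functions converge to `v` in `L²(Γ)` and their tangential gradients
converge to `Dv` in `L²(Γ)`. -/
def HasSurfaceGradient (Ω : Set (E d)) (v : E d → ℝ) (Dv : E d → E d) : Prop :=
  MemLp v 2 (surfaceMeasure Ω) ∧ MemLp Dv 2 (surfaceMeasure Ω) ∧
    ∃ φ : ℕ → E d → ℝ, (∀ k, IsTest (φ k)) ∧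
      Tendsto (fun k => eLpNorm (fun x => φ k x - v x) 2 (surfaceMeasure Ω)) atTop (𝓝 0) ∧
      Tendsto (fun k => eLpNorm (fun x => tangentialGradient Ω (φ k) x - Dv x) 2
        (surfaceMeasure Ω)) atTop (𝓝 0)

/-- An element of `H²(Γ)`, together with its surface gradient `grad` and, for each `i`, the surface
gradient `hess i` of the `i`-th component of the surface gradient. -/
structure SurfaceH2 (Ω : Set (E d)) where
  val : E d → ℝ
  grad : E d → E d
  hess : Fin d → E d → E d
  surf_grad : HasSurfaceGradient Ω val grad
  surf_hess : ∀ i, HasSurfaceGradient Ω (fun x => grad x i) (hess i)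

/-- `L ∈ L²(Γ)` is the Laplace-Beltrami operator `Δ_Γ v = div_Γ ∇_Γ v` applied to `v`, in the sense of
distributions on the closed surface `Γ`. -/
def HasLaplaceBeltrami {Ω : Set (E d)} (v : SurfaceH2 Ω) (L : E d → ℝ) : Prop :=
  MemLp L 2 (surfaceMeasure Ω) ∧ ∀ ξ : E d → ℝ, IsTest ξ →
    ∫ x, L x * ξ x ∂surfaceMeasure Ω
      = - ∫ x, (inner ℝ (v.grad x) (tangentialGradient Ω ξ x) : ℝ) ∂surfaceMeasure Ω

/-! ### Norms -/

/-- The norm of `(f, g)` in `L²(Ω) × L²(Γ)`. -/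
def normL2 (Ω : Set (E d)) (f g : E d → ℝ) : ℝ :=
  Real.sqrt ((∫ x, f x ^ 2 ∂bulkMeasure Ω) + ∫ x, g x ^ 2 ∂surfaceMeasure Ω)

/-- The norm in `H¹(Ω) × H¹(Γ)` of the pair `(u, v)` with gradients `Du` and `Dv`. -/
def normH1 (Ω : Set (E d)) (u : E d → ℝ) (Du : E d → E d) (v : E d → ℝ) (Dv : E d → E d) : ℝ :=
  Real.sqrt ((∫ x, u x ^ 2 + ‖Du x‖ ^ 2 ∂bulkMeasure Ω)
    + ∫ x, v x ^ 2 + ‖Dv x‖ ^ 2 ∂surfaceMeasure Ω)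

/-! ### Potentials and solutions -/

/-- The assumptions on a single singular potential `F : [-1, 1] → ℝ` with convexity constant `Θ`.
Values of `F` outside of `[-1, 1]` play no role. -/
structure IsSingularPotential (Θ : ℝ) (F : ℝ → ℝ) : Prop where
  continuousOn : ContinuousOn F (Icc (-1) 1)
  contDiffOn : ContDiffOn ℝ 2 F (Ioo (-1) 1)
  tendsto_left : Tendsto (deriv F) (𝓝[>] (-1)) atBot
  tendsto_right : Tendsto (deriv F) (𝓝[<] 1) atTop
  convex : ∀ s ∈ Ioo (-1 : ℝ) 1, Θ ≤ deriv (deriv F) s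
  zero : F 0 = 0
  deriv_zero : deriv F 0 = 0

/-- `G` dominates `F`: `|F'(α s)| ≤ κ₁ |G'(s)| + κ₂` on `(-1, 1)` for some `κ₁, κ₂ > 0`. -/
def Dominates (α : ℝ) (F G : ℝ → ℝ) : Prop :=
  ∃ κ₁ > 0, ∃ κ₂ > 0, ∀ s ∈ Ioo (-1 : ℝ) 1, |deriv F (α * s)| ≤ κ₁ * |deriv G s| + κ₂

/-- `(u, v) ∈ H²(Ω) × H²(Γ)` is a (strong) solution of the bulk-surface elliptic system
`-Δu + F'(u) = f` in `Ω`, `-Δ_Γ v + G'(v) + α ∂ₙu = g` on `Γ`, `K ∂ₙu = α v - u` on `Γ`,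
the equations holding almost everywhere, with `F'(u)` and `G'(v)` square integrable. Here `uΓ` is
the trace of `u`, `DuΓ` is the trace of `∇u`, and `∂ₙu = DuΓ · n`. If `K = 0`, the last equation
is the condition `u = α v` on `Γ` that defines the space `H¹_{0,α}`. -/
structure IsSolution (Ω : Set (E d)) (K α : ℝ) (F G : ℝ → ℝ) (f g : E d → ℝ)
    (u : BulkH2 Ω) (v : SurfaceH2 Ω) : Prop where
  bulk_range : ∀ᵐ x ∂bulkMeasure Ω, |u.val x| < 1
  surface_range : ∀ᵐ x ∂surfaceMeasure Ω, |v.val x| < 1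
  memLp_bulk : MemLp (fun x => deriv F (u.val x)) 2 (bulkMeasure Ω)
  memLp_surface : MemLp (fun x => deriv G (v.val x)) 2 (surfaceMeasure Ω)
  bulk_eq : ∀ᵐ x ∂bulkMeasure Ω, - u.laplacian x + deriv F (u.val x) = f x
  boundary_eq : ∃ (uΓ : E d → ℝ) (DuΓ : E d → E d) (L : E d → ℝ),
    HasTrace Ω u.val u.grad uΓ ∧
    (∀ i, HasTrace Ω (fun x => u.grad x i) (u.hess i) (fun x => DuΓ x i)) ∧
    HasLaplaceBeltrami v L ∧
    (∀ᵐ x ∂surfaceMeasure Ω,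
      - L x + deriv G (v.val x) + α * inner ℝ (DuΓ x) (outwardNormal Ω x) = g x) ∧
    (∀ᵐ x ∂surfaceMeasure Ω,
      K * inner ℝ (DuΓ x) (outwardNormal Ω x) = α * v.val x - uΓ x)

end BulkSurface

end

/-!
Continuous dependence is an energy estimate. Subtract the two solutions, `U = u₁ - u₂` and
`V = v₁ - v₂`, and test the bulk equation with `U`, the surface equation with `V`. Green's formulas
turn the second-order terms into `∫_Ω |∇U|²` and `∫_Γ |∇_Γ V|²`, and leave the boundary term
`∫_Γ ∂ₙU (α V - U)`, which is `K ∫_Γ |∂ₙU|² ≥ 0` by the coupling condition (and zero if `K = 0`).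
Since `F'' ≥ ΘΩ` and `G'' ≥ ΘΓ`, the nonlinear terms dominate `ΘΩ ∫_Ω U²` and `ΘΓ ∫_Γ V²`
(`IsSingularPotential.mul_sq_sub_le`). Young's inequality then gives the estimate with
`C = 1 / min 1 (min ΘΩ ΘΓ)`, and uniqueness is the case of equal right-hand sides. All products are
integrable because the singular terms `F'(u)` and `G'(v)` of a solution are square integrable.

The substance is Green's formula in the bulk (`green_formula`). Traces are limits of restrictions
of smooth functions, so it reduces to the Gauss-Green formula `∫_Ω ∂ₑw = ∫_Γ w ⟨n, e⟩` for compactly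
supported `C¹` functions `w`, the integral over `Γ` being taken with respect to Hausdorff measure
(`IsBoundedC2Domain.gaussGreen`). That formula is localised with bump functions to balls in which
`Ω` lies below a graph. There the shear `(y, t) ↦ y + (t + g y) ν` preserves volume and straightens
the graph, and the fundamental theorem of calculus gives the formula with boundary density
`ν - ∇g` (`integral_fderiv_subgraph`). The area formula for injective `C¹` immersions
(`comap_euclideanHausdorffMeasure`) identifies the Hausdorff measure of the graph as `|ν - ∇g| dy`,
and `(ν - ∇g) / |ν - ∇g|` is the outward normal. The area formula itself holds because an immersion
distorts distances near each point as its derivative does, up to a factor arbitrarily close to one,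
and linear images scale Hausdorff measure by their Jacobian.
-/

noncomputable section

namespace BulkSurface

open scoped NNReal ENNReal

/-! ### Area formula for injective immersions -/

section AreaFormula

/-- If `f` expands distances at most `K` times as much as `g` does, then `f '' s` is a `K`-Lipschitz
image of `g '' s`. -/
theorem hausdorffMeasure_image_le_of_edist_le {X Y Z : Type*} [EMetricSpace X] [MeasurableSpace X]
    [BorelSpace X] [EMetricSpace Y] [MeasurableSpace Y] [BorelSpace Y] {f : Z → X} {g : Z → Y}
    {s : Set Z} {K : ℝ≥0} (h : ∀ a ∈ s, ∀ b ∈ s, edist (f a) (f b) ≤ K * edist (g a) (g b))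
    (m : ℕ) : μHE[m] (f '' s) ≤ (K : ℝ≥0∞) ^ m * μHE[m] (g '' s) := by
  classical
  rcases s.eq_empty_or_nonempty with rfl | ⟨z, -⟩
  · simp
  have : Nonempty Z := ⟨z⟩
  set k : Y → X := f ∘ Function.invFunOn g s with hk
  have hinv : ∀ a ∈ s, Function.invFunOn g s (g a) ∈ s ∧ g (Function.invFunOn g s (g a)) = g a :=
    fun a ha => ⟨Function.invFunOn_mem ⟨a, ha, rfl⟩, Function.invFunOn_eq ⟨a, ha, rfl⟩⟩
  have hka : ∀ a ∈ s, k (g a) = f a := by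
    intro a ha
    have h1 := h _ (hinv a ha).1 a ha
    rw [(hinv a ha).2, edist_self, mul_zero, nonpos_iff_eq_zero, edist_eq_zero] at h1
    exact h1
  have hL : LipschitzOnWith K k (g '' s) := by
    rintro _ ⟨a, ha, rfl⟩ _ ⟨b, hb, rfl⟩
    rw [hka a ha, hka b hb]
    exact h a ha b hb
  have himg : k '' (g '' s) = f '' s := by
    rw [image_image]
    exact image_congr hka
  have := hL.hausdorffMeasure_image_le (d := (m : ℝ)) (by positivity)
  rw [himg, ENNReal.rpow_natCast] at this
  simp only [Measure.euclideanHausdorffMeasure_def, Measure.smul_apply, ENNReal.smul_def,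
    smul_eq_mul]
  rw [mul_left_comm]
  gcongr

/-- A measure inequality can be checked locally. -/
theorem measure_le_of_locally_le {X : Type*} [TopologicalSpace X] [SecondCountableTopology X]
    [MeasurableSpace X] [OpensMeasurableSpace X] {μ ν : Measure X}
    (h : ∀ x, ∃ u ∈ 𝓝 x, ∀ s ⊆ u, MeasurableSet s → μ s ≤ ν s) : μ ≤ ν := by
  choose u hu hle using h
  obtain ⟨t, htc, ht⟩ := TopologicalSpace.countable_cover_nhds
    (f := fun x => interior (u x)) (fun x => interior_mem_nhds.2 (hu x))
  rcases t.eq_empty_or_nonempty with rfl | hne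
  · rw [Measure.le_iff]
    intro s _
    have : s = ∅ := eq_empty_of_subset_empty ((subset_univ s).trans (by simp [← ht]))
    simp [this]
  obtain ⟨c, hc⟩ := htc.exists_eq_range hne
  set v : ℕ → Set X := disjointed fun n => interior (u (c n)) with hv
  have hvm : ∀ n, MeasurableSet (v n) :=
    fun n => MeasurableSet.disjointed (fun n => isOpen_interior.measurableSet) n
  have hvd : Pairwise (Function.onFun Disjoint v) := disjoint_disjointed _
  have hvu : ⋃ n, v n = univ := by
    rw [hv, iUnion_disjointed, ← ht, hc, biUnion_range]
  rw [Measure.le_iff]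
  intro s hs
  have hdec : ∀ ρ : Measure X, ρ s = ∑' n, ρ (s ∩ v n) := by
    intro ρ
    rw [← measure_iUnion (fun i j hij => (hvd hij).mono inter_subset_right inter_subset_right)
      (fun n => hs.inter (hvm n)), ← inter_iUnion, hvu, inter_univ]
  rw [hdec μ, hdec ν]
  refine ENNReal.tsum_le_tsum fun n => hle (c n) _ ?_ (hs.inter (hvm n))
  exact (inter_subset_right.trans (disjointed_subset _ n)).trans interior_subset

theorem measure_le_of_forall_one_lt {X : Type*} [MeasurableSpace X] {μ ν : Measure X} (m : ℕ)
    (h : ∀ K : ℝ≥0, 1 < K → μ ≤ (K : ℝ≥0∞) ^ m • ν) : μ ≤ ν := by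
  rw [Measure.le_iff]
  intro s _
  have hK : Tendsto (fun n : ℕ => (1 : ℝ≥0) + 1 / ((n : ℝ≥0) + 1)) atTop (𝓝 (1 + 0)) :=
    tendsto_const_nhds.add (tendsto_one_div_add_atTop_nhds_zero_nat (𝕜 := ℝ≥0))
  rw [add_zero] at hK
  have h2 : Tendsto (fun n : ℕ => (((1 : ℝ≥0) + 1 / ((n : ℝ≥0) + 1) : ℝ≥0) : ℝ≥0∞) ^ m * ν s)
      atTop (𝓝 (((1 : ℝ≥0) : ℝ≥0∞) ^ m * ν s)) := by
    refine ENNReal.Tendsto.mul_const ?_ (Or.inl (by simp))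
    exact ((ENNReal.continuous_pow m).tendsto _).comp ((ENNReal.continuous_coe.tendsto _).comp hK)
  simp only [ENNReal.coe_one, one_pow, one_mul] at h2
  refine ge_of_tendsto' h2 fun n => ?_
  have := h (1 + 1 / ((n : ℝ≥0) + 1)) (by simp) s
  simpa using this

variable {U V : Type*} [NormedAddCommGroup U] [InnerProductSpace ℝ U] [FiniteDimensional ℝ U]
  [NormedAddCommGroup V] [InnerProductSpace ℝ V]

theorem continuous_normDet [FiniteDimensional ℝ V] :
    Continuous fun A : U →L[ℝ] V => A.toLinearMap.normDet := by
  have h : (fun A : U →L[ℝ] V => A.toLinearMap.normDet)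
      = fun A => Real.sqrt ((A.adjoint ∘L A).det) := by
    ext A
    have := ContinuousLinearMap.normDet_sq A
    rw [← this]
    exact (Real.sqrt_sq (LinearMap.normDet_nonneg _)).symm
  rw [h]
  refine Real.continuous_sqrt.comp (ContinuousLinearMap.continuous_det.comp ?_)
  exact (ContinuousLinearMap.adjoint.continuous).clm_comp continuous_id

/-- Near a point where it is strictly differentiable with injective derivative, a map distorts
distances as its derivative does, up to a factor arbitrarily close to one. -/
theorem exists_nhds_edist_comparable {f : U → V} {A : U →L[ℝ] V} {x : U}
    (hf : HasStrictFDerivAt f A x) (hA : Function.Injective A) {K : ℝ≥0} (hK : 1 < K) :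
    ∃ u ∈ 𝓝 x, ∀ a ∈ u, ∀ b ∈ u, edist (f a) (f b) ≤ K * edist (A a) (A b) ∧
      edist (A a) (A b) ≤ K * edist (f a) (f b) := by
  obtain ⟨c, hc0, hc⟩ := A.toLinearMap.exists_antilipschitzWith (LinearMap.ker_eq_bot.2 hA)
  have hK0 : (0 : ℝ) < K := by positivity
  have hK1 : (1 : ℝ) < K := by exact_mod_cast hK
  have hcA : ∀ v, ‖v‖ ≤ c * ‖A v‖ := fun v => by
    have := hc.le_mul_dist v 0
    simpa using this
  have hc0' : (0 : ℝ) < c := by exact_mod_cast hc0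
  -- with this `ε` the error `ε ‖a - b‖` of the linearisation is at most `(1 - K⁻¹) ‖A (a - b)‖`
  set ε : ℝ := (1 - (K : ℝ)⁻¹) / c with hε
  have hεpos : 0 < ε := by
    have : (K : ℝ)⁻¹ < 1 := inv_lt_one_of_one_lt₀ hK1
    exact div_pos (by linarith) hc0'
  have h1 := hf.isLittleO.def hεpos
  obtain ⟨u, w, huo, hxu, hwo, hxw, hsub⟩ := mem_nhds_prod_iff'.1 (show _ ∈ 𝓝 (x, x) from h1)
  refine ⟨u ∩ w, (huo.inter hwo).mem_nhds ⟨hxu, hxw⟩, fun a ha b hb => ?_⟩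
  have h2 : ‖f a - f b - A (a - b)‖ ≤ ε * ‖a - b‖ := hsub (mk_mem_prod ha.1 hb.2)
  have h3 : ‖f a - f b - A (a - b)‖ ≤ (1 - (K : ℝ)⁻¹) * ‖A (a - b)‖ := by
    refine h2.trans ((mul_le_mul_of_nonneg_left (hcA _) hεpos.le).trans (le_of_eq ?_))
    rw [hε]; field_simp
  have h4 := norm_sub_norm_le (f a - f b) (A (a - b))
  have h5 := norm_sub_norm_le (A (a - b)) (f a - f b)
  rw [norm_sub_rev (A (a - b))] at h5
  have h6 : (1 - (K : ℝ)⁻¹) ≤ K - 1 := by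
    rw [← sub_nonneg]
    have : (K : ℝ) - 1 - (1 - (K : ℝ)⁻¹) = (K - 1) ^ 2 / K := by field_simp
    rw [this]; positivity
  have h7 : ‖f a - f b‖ ≤ K * ‖A (a - b)‖ := by
    nlinarith [norm_nonneg (A (a - b))]
  have h8 : ‖A (a - b)‖ ≤ K * ‖f a - f b‖ := by
    have : (K : ℝ)⁻¹ * ‖A (a - b)‖ ≤ ‖f a - f b‖ := by linarith
    rwa [inv_mul_le_iff₀ hK0] at this
  have hof : ∀ r : ℝ, (K : ℝ≥0∞) * ENNReal.ofReal r = ENNReal.ofReal (K * r) := fun r => by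
    rw [ENNReal.ofReal_mul hK0.le, ENNReal.ofReal_coe_nnreal]
  rw [map_sub] at h7 h8
  simp only [edist_dist, dist_eq_norm, hof]
  exact ⟨ENNReal.ofReal_le_ofReal h7, ENNReal.ofReal_le_ofReal h8⟩

variable [FiniteDimensional ℝ V] [MeasurableSpace U] [BorelSpace U] [MeasurableSpace V]
  [BorelSpace V]

/-- **Area formula** for an injective `C¹` immersion `f`: the Hausdorff measure of the image, seen
on the source, has as density the Jacobian `√det (f'ᵀ f')`. -/
theorem comap_euclideanHausdorffMeasure {f : U → V} (hf : ContDiff ℝ 1 f)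
    (hinj : Function.Injective f) (himm : ∀ x, Function.Injective (fderiv ℝ f x)) :
    (μHE[Module.finrank ℝ U] : Measure V).comap f
      = volume.withDensity fun x => ENNReal.ofReal (fderiv ℝ f x).toLinearMap.normDet := by
  set m := Module.finrank ℝ U with hm
  set J : U → ℝ := fun x => (fderiv ℝ f x).toLinearMap.normDet with hJ
  have hJc : Continuous J := continuous_normDet.comp (hf.continuous_fderiv one_ne_zero)
  have hJpos : ∀ x, 0 < J x := fun x => lt_of_le_of_ne (LinearMap.normDet_nonneg _)
    (Ne.symm ((LinearMap.normDet_ne_zero_tfae (fderiv ℝ f x).toLinearMap).out 0 4 |>.2 (himm x)))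
  have hemb : MeasurableEmbedding f := hf.continuous.measurableEmbedding hinj
  -- both measures are, near `x`, comparable with `J x` times the volume
  have key : ∀ K : ℝ≥0, 1 < K → ∀ x, ∃ u ∈ 𝓝 x, ∀ s ⊆ u, MeasurableSet s →
      μHE[m] (f '' s) ≤ (K : ℝ≥0∞) ^ (m + 1) * ∫⁻ y in s, ENNReal.ofReal (J y) ∧
      ∫⁻ y in s, ENNReal.ofReal (J y) ≤ (K : ℝ≥0∞) ^ (m + 1) * μHE[m] (f '' s) := by
    intro K hK x
    have hK1 : (1 : ℝ) < K := by exact_mod_cast hK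
    obtain ⟨u, hu, hcmp⟩ := exists_nhds_edist_comparable
      (hf.contDiffAt.hasStrictFDerivAt one_ne_zero) (himm x) hK
    have hlow : {y | J x < K * J y} ∈ 𝓝 x :=
      (isOpen_lt continuous_const (continuous_const.mul hJc)).mem_nhds
        (show J x < K * J x by nlinarith [hJpos x])
    have hupp : {y | J y < K * J x} ∈ 𝓝 x :=
      (isOpen_lt hJc continuous_const).mem_nhds (show J x < K * J x by nlinarith [hJpos x])
    refine ⟨u ∩ ({y | J x < K * J y} ∩ {y | J y < K * J x}), inter_mem hu (inter_mem hlow hupp),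
      fun s hs hsm => ?_⟩
    have hlin : μHE[m] (fderiv ℝ f x '' s) = ENNReal.ofReal (J x) * volume s :=
      (fderiv ℝ f x).toLinearMap.euclideanHausdorffMeasure_image_eq_normDet_mul_volume s
    have h1 := hausdorffMeasure_image_le_of_edist_le (f := f) (g := fderiv ℝ f x) (s := s) (K := K)
      (fun a ha b hb => (hcmp a (hs ha).1 b (hs hb).1).1) m
    have h2 := hausdorffMeasure_image_le_of_edist_le (f := fderiv ℝ f x) (g := f) (s := s) (K := K)
      (fun a ha b hb => (hcmp a (hs ha).1 b (hs hb).1).2) m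
    rw [hlin] at h1 h2
    have hof : ∀ r : ℝ, (K : ℝ≥0∞) * ENNReal.ofReal r = ENNReal.ofReal (K * r) := fun r => by
      rw [ENNReal.ofReal_mul (by positivity), ENNReal.ofReal_coe_nnreal]
    have h3 : ENNReal.ofReal (J x) * volume s ≤ K * ∫⁻ y in s, ENNReal.ofReal (J y) := by
      rw [← lintegral_const_mul _ (by fun_prop), ← setLIntegral_const]
      refine setLIntegral_mono (by fun_prop) fun y hy => ?_
      rw [hof]
      exact ENNReal.ofReal_le_ofReal (hs hy).2.1.le
    have h4 : ∫⁻ y in s, ENNReal.ofReal (J y) ≤ K * (ENNReal.ofReal (J x) * volume s) := by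
      rw [← mul_assoc, hof, ← setLIntegral_const]
      exact setLIntegral_mono (by fun_prop) fun y hy => ENNReal.ofReal_le_ofReal (hs hy).2.2.le
    refine ⟨h1.trans ?_, h4.trans ?_⟩
    · rw [pow_succ, mul_assoc]; gcongr
    · rw [pow_succ', mul_assoc]; gcongr
  refine le_antisymm ?_ ?_
  · refine measure_le_of_forall_one_lt (m + 1) fun K hK => measure_le_of_locally_le fun x => ?_
    obtain ⟨u, hu, h⟩ := key K hK x
    refine ⟨u, hu, fun s hs hsm => ?_⟩
    rw [hemb.comap_apply, Measure.smul_apply, withDensity_apply _ hsm, smul_eq_mul]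
    exact (h s hs hsm).1
  · refine measure_le_of_forall_one_lt (m + 1) fun K hK => measure_le_of_locally_le fun x => ?_
    obtain ⟨u, hu, h⟩ := key K hK x
    refine ⟨u, hu, fun s hs hsm => ?_⟩
    rw [Measure.smul_apply, hemb.comap_apply, withDensity_apply _ hsm, smul_eq_mul]
    exact (h s hs hsm).2

end AreaFormula

/-! ### The Gauss-Green formula below a graph -/

section Graph

variable {V : Type*} [NormedAddCommGroup V] [InnerProductSpace ℝ V]

/-- The orthogonal projection onto the hyperplane orthogonal to `ν`, with values in that
hyperplane. -/
abbrev hyperplaneProj (ν : V) : V →L[ℝ] (ℝ ∙ ν)ᗮ := (ℝ ∙ ν)ᗮ.orthogonalProjectionOnto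

theorem inner_hyperplane (ν : V) (y : (ℝ ∙ ν)ᗮ) : inner ℝ ν (y : V) = 0 :=
  Submodule.mem_orthogonal_singleton_iff_inner_right.1 y.2

theorem hyperplaneProj_add_smul (ν : V) (y : (ℝ ∙ ν)ᗮ) (t : ℝ) :
    hyperplaneProj ν ((y : V) + t • ν) = y := by
  rw [map_add, map_smul, Submodule.orthogonalProjectionOnto_mem_subspace_eq_self,
    Submodule.orthogonalProjectionOnto_orthogonal_apply_eq_zero, smul_zero, add_zero]
  exact Submodule.mem_span_singleton_self ν

theorem hyperplaneProj_add_inner_smul {ν : V} (hν : ‖ν‖ = 1) (x : V) :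
    (hyperplaneProj ν x : V) + (inner ℝ ν x : ℝ) • ν = x := by
  have := Submodule.starProjection_add_starProjection_orthogonal (K := ℝ ∙ ν) x
  rw [Submodule.starProjection_unit_singleton ℝ hν] at this
  rw [add_comm]
  exact this

/-- The homeomorphism `(y, t) ↦ y + (t + g y) ν` from `ν^⊥ × ℝ` onto the whole space; it
straightens the graph of `g`. -/
def graphCoords {ν : V} (hν : ‖ν‖ = 1) {g : (ℝ ∙ ν)ᗮ → ℝ} (hg : Continuous g) :
    (ℝ ∙ ν)ᗮ × ℝ ≃ₜ V where
  toFun p := (p.1 : V) + (p.2 + g p.1) • ν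
  invFun x := (hyperplaneProj ν x, inner ℝ ν x - g (hyperplaneProj ν x))
  left_inv := by
    rintro ⟨y, t⟩
    simp only [hyperplaneProj_add_smul, inner_add_right, inner_hyperplane, inner_smul_right,
      real_inner_self_eq_norm_sq, hν]
    simp
  right_inv x := by
    simp only [sub_add_cancel]
    exact hyperplaneProj_add_inner_smul hν x
  continuous_toFun := by fun_prop
  continuous_invFun := by fun_prop

theorem graphCoords_apply {ν : V} (hν : ‖ν‖ = 1) {g : (ℝ ∙ ν)ᗮ → ℝ} (hg : Continuous g)
    (p : (ℝ ∙ ν)ᗮ × ℝ) : graphCoords hν hg p = (p.1 : V) + (p.2 + g p.1) • ν := rfl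

/-- The region below the graph of `g`, the graph being taken over `ν^⊥`. -/
def subgraph (ν : V) (g : (ℝ ∙ ν)ᗮ → ℝ) : Set V := {x | inner ℝ ν x < g (hyperplaneProj ν x)}

theorem graphCoords_preimage_subgraph {ν : V} (hν : ‖ν‖ = 1) {g : (ℝ ∙ ν)ᗮ → ℝ}
    (hg : Continuous g) : graphCoords hν hg ⁻¹' subgraph ν g = univ ×ˢ Iio 0 := by
  ext ⟨y, t⟩
  simp only [mem_preimage, subgraph, mem_ofPred_eq, graphCoords_apply, hyperplaneProj_add_smul,
    inner_add_right, inner_hyperplane, inner_smul_right, real_inner_self_eq_norm_sq, hν, mem_prod,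
    mem_univ, true_and, mem_Iio]
  constructor <;> intro h <;> linarith

variable [FiniteDimensional ℝ V] [MeasurableSpace V] [BorelSpace V]

theorem measurePreserving_graphCoords {ν : V} (hν : ‖ν‖ = 1) {g : (ℝ ∙ ν)ᗮ → ℝ}
    (hg : Continuous g) :
    MeasurePreserving (graphCoords hν hg) (volume.prod volume) volume := by
  have h0 : MeasurePreserving (fun p : (ℝ ∙ ν)ᗮ × ℝ => (p.1, p.2 + g p.1))
      (volume.prod volume) (volume.prod volume) := by
    refine (MeasurePreserving.id volume).skew_product (g := fun y t => t + g y) ?_ ?_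
    · exact (continuous_snd.add (hg.comp continuous_fst)).measurable
    · exact Eventually.of_forall fun y => (measurePreserving_add_right volume (g y)).map_eq
  have h1 : MeasurePreserving (fun p : (ℝ ∙ ν)ᗮ × ℝ =>
      (p.1, LinearIsometryEquiv.toSpanUnitSingleton ν hν p.2))
      (volume.prod volume) (volume.prod volume) :=
    (MeasurePreserving.id volume).prod (LinearIsometryEquiv.measurePreserving _)
  have h2 : MeasurePreserving (Prod.swap : (ℝ ∙ ν)ᗮ × (ℝ ∙ ν) → (ℝ ∙ ν) × (ℝ ∙ ν)ᗮ)
      (volume.prod volume) (volume.prod volume) := Measure.measurePreserving_swap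
  have h3 := WithLp.volume_preserving_toLp (ℝ ∙ ν) (ℝ ∙ ν)ᗮ
  have h4 := (ℝ ∙ ν).orthogonalDecomposition.symm.measurePreserving
  refine (congrArg (fun f => MeasurePreserving f (volume.prod volume) volume) ?_).mp
    (h4.comp (h3.comp (h2.comp (h1.comp h0))))
  funext p
  simp [graphCoords_apply, add_comm]

theorem integral_fderiv_apply_eq_zero {f : V → ℝ} (hf : ContDiff ℝ 1 f)
    (hc : HasCompactSupport f) (v : V) : ∫ x, fderiv ℝ f x v = 0 := by
  have hi : Integrable (fun x => fderiv ℝ f x v) :=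
    ((hf.continuous_fderiv one_ne_zero).clm_apply continuous_const).integrable_of_hasCompactSupport
      (hc.fderiv_apply ℝ v)
  have := integral_mul_fderiv_eq_neg_fderiv_mul_of_integrable (μ := (volume : Measure V))
    (f := fun _ => (1 : ℝ)) (g := f) (v := v) (by simp) (by simpa using hi)
    (by simpa using hf.continuous.integrable_of_hasCompactSupport hc) (by simp)
    (fun x _ => (hf.differentiable one_ne_zero) x)
  simpa using this

/-- The Gauss-Green formula below a graph: the boundary term is expressed in the coordinate `y` of
the graph, where `ν - ∇g(y)` is the normal vector times the area density. -/
theorem integral_fderiv_subgraph {ν : V} (hν : ‖ν‖ = 1) {g : (ℝ ∙ ν)ᗮ → ℝ}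
    (hg : ContDiff ℝ 1 g) {w : V → ℝ} (hw : ContDiff ℝ 1 w) (hc : HasCompactSupport w) (e : V) :
    ∫ x in subgraph ν g, fderiv ℝ w x e
      = ∫ y : (ℝ ∙ ν)ᗮ, w (y + g y • ν) * (inner ℝ ν e - fderiv ℝ g y (hyperplaneProj ν e)) := by
  set Φ := graphCoords hν hg.continuous with hΦ
  set h := hyperplaneProj ν e with hh
  set c : (ℝ ∙ ν)ᗮ → ℝ := fun y => inner ℝ ν e - fderiv ℝ g y h with hcdef
  have hcc : Continuous c :=
    continuous_const.sub ((hg.continuous_fderiv one_ne_zero).clm_apply continuous_const)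
  set W : (ℝ ∙ ν)ᗮ × ℝ → ℝ := w ∘ Φ with hW
  have hΦd : ContDiff ℝ 1 (Φ : (ℝ ∙ ν)ᗮ × ℝ → V) := by
    have : (Φ : (ℝ ∙ ν)ᗮ × ℝ → V) = fun p => (ℝ ∙ ν)ᗮ.subtypeL p.1 + (p.2 + g p.1) • ν := rfl
    rw [this]
    fun_prop
  have hWd : ContDiff ℝ 1 W := hw.comp hΦd
  have hWc : HasCompactSupport W := hc.comp_homeomorph Φ
  have hΦ' : ∀ p : (ℝ ∙ ν)ᗮ × ℝ, ∀ k : (ℝ ∙ ν)ᗮ, ∀ s : ℝ,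
      fderiv ℝ W p (k, s) = fderiv ℝ w (Φ p) ((k : V) + (s + fderiv ℝ g p.1 k) • ν) := by
    intro p k s
    have hgp : HasFDerivAt g (fderiv ℝ g p.1) p.1 :=
      (hg.differentiable one_ne_zero p.1).hasFDerivAt
    have h1 : HasFDerivAt (Φ : (ℝ ∙ ν)ᗮ × ℝ → V)
        ((ℝ ∙ ν)ᗮ.subtypeL ∘L ContinuousLinearMap.fst ℝ _ ℝ + (ContinuousLinearMap.snd ℝ _ ℝ
          + fderiv ℝ g p.1 ∘L ContinuousLinearMap.fst ℝ _ ℝ).smulRight ν) p :=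
      (((ℝ ∙ ν)ᗮ.subtypeL.hasFDerivAt).comp p hasFDerivAt_fst).add
        ((hasFDerivAt_snd.add (hgp.comp p hasFDerivAt_fst)).smul_const ν)
    have h2 := ((hw.differentiable one_ne_zero (Φ p)).hasFDerivAt).comp p h1
    rw [hW, h2.fderiv]
    simp
  -- decompose `e` into the fibre direction `ν` and a vector tangent to the graph
  have hsplit : ∀ p : (ℝ ∙ ν)ᗮ × ℝ,
      fderiv ℝ w (Φ p) e = c p.1 * fderiv ℝ W p (0, 1) + fderiv ℝ W p (h, 0) := by
    intro p
    rw [hΦ', hΦ', ← smul_eq_mul, ← map_smul, ← map_add]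
    congr 1
    conv_lhs => rw [← hyperplaneProj_add_inner_smul hν e]
    simp only [hcdef, ← hh, map_zero, ZeroMemClass.coe_zero, add_zero, zero_add, one_smul, sub_smul]
    abel
  have hi1 : Integrable (fun p : (ℝ ∙ ν)ᗮ × ℝ => c p.1 * fderiv ℝ W p (0, 1))
      (volume.prod volume) := by
    refine Continuous.integrable_of_hasCompactSupport ?_ ?_
    · exact (hcc.comp continuous_fst).mul
        ((hWd.continuous_fderiv one_ne_zero).clm_apply continuous_const)
    · exact (hWc.fderiv_apply ℝ _).mul_left
  have hi2 : Integrable (fun p : (ℝ ∙ ν)ᗮ × ℝ => fderiv ℝ W p (h, 0)) (volume.prod volume) :=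
    ((hWd.continuous_fderiv one_ne_zero).clm_apply continuous_const).integrable_of_hasCompactSupport
      (hWc.fderiv_apply ℝ _)
  rw [← (measurePreserving_graphCoords hν hg.continuous).setIntegral_preimage_emb
    (graphCoords hν hg.continuous).measurableEmbedding, graphCoords_preimage_subgraph]
  simp only [← hΦ, hsplit]
  rw [integral_add hi1.integrableOn hi2.integrableOn]
  have e1 : ∫ p in univ ×ˢ Iio 0, c p.1 * fderiv ℝ W p (0, 1)
      ∂((volume : Measure (ℝ ∙ ν)ᗮ).prod (volume : Measure ℝ)) = ∫ y, w (y + g y • ν) * c y := by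
    rw [setIntegral_prod _ hi1.integrableOn, setIntegral_univ]
    refine integral_congr_ae (Eventually.of_forall fun y => ?_)
    simp only
    rw [integral_const_mul, mul_comm, ← integral_Iic_eq_integral_Iio]
    congr 1
    have hsl : ContDiff ℝ 1 (fun t : ℝ => W (y, t)) := hWd.comp (contDiff_prodMk_right y)
    have hslc : HasCompactSupport (fun t : ℝ => W (y, t)) :=
      hWc.comp_isClosedEmbedding (Function.LeftInverse.isClosedEmbedding (f := Prod.snd)
        (fun _ => rfl) continuous_snd (by fun_prop))
    have hder : ∀ t : ℝ, fderiv ℝ W (y, t) (0, 1) = deriv (fun t : ℝ => W (y, t)) t := by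
      intro t
      have := ((hWd.differentiable one_ne_zero (y, t)).hasFDerivAt).comp_hasDerivAt t
        ((hasDerivAt_const t y).prodMk (hasDerivAt_id t))
      exact this.deriv.symm
    simp only [hder]
    rw [hslc.integral_Iic_deriv_eq hsl]
    simp [hW, hΦ, graphCoords_apply]
  have e2 : ∫ p in univ ×ˢ Iio 0, fderiv ℝ W p (h, 0)
      ∂((volume : Measure (ℝ ∙ ν)ᗮ).prod (volume : Measure ℝ)) = 0 := by
    have hi2' := hi2.integrableOn (s := univ ×ˢ Iio 0)
    rw [IntegrableOn, ← Measure.prod_restrict] at hi2'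
    rw [← Measure.prod_restrict, integral_prod_symm _ hi2']
    refine integral_eq_zero_of_ae (Eventually.of_forall fun t => ?_)
    simp only [Measure.restrict_univ, Pi.zero_apply]
    have hsl : ContDiff ℝ 1 (fun y : (ℝ ∙ ν)ᗮ => W (y, t)) := hWd.comp (contDiff_prodMk_left t)
    have hslc : HasCompactSupport (fun y : (ℝ ∙ ν)ᗮ => W (y, t)) :=
      hWc.comp_isClosedEmbedding (Function.LeftInverse.isClosedEmbedding (f := Prod.fst)
        (fun _ => rfl) continuous_fst (by fun_prop))
    refine Eq.trans ?_ (integral_fderiv_apply_eq_zero hsl hslc h)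
    refine integral_congr_ae (Eventually.of_forall fun y => ?_)
    have := ((hWd.differentiable one_ne_zero (y, t)).hasFDerivAt).comp y
      ((hasFDerivAt_id (𝕜 := ℝ) y).prodMk (hasFDerivAt_const t y))
    have h3 := this.fderiv
    simp only [Function.comp_def, id] at h3
    simp [h3]
  rw [e1, e2, add_zero]

end Graph

/-! ### Normal vector and Hausdorff measure of a graph -/

section GraphSurface

variable {V : Type*} [NormedAddCommGroup V] [InnerProductSpace ℝ V]

/-- The graph of `g`, taken over `ν^⊥`. -/
def graphOver (ν : V) (g : (ℝ ∙ ν)ᗮ → ℝ) : Set V := {x | inner ℝ ν x = g (hyperplaneProj ν x)}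

/-- The parametrization `y ↦ y + g(y) ν` of the graph of `g`. -/
def graphParam (ν : V) (g : (ℝ ∙ ν)ᗮ → ℝ) (y : (ℝ ∙ ν)ᗮ) : V := (y : V) + g y • ν

theorem hyperplaneProj_graphParam (ν : V) (g : (ℝ ∙ ν)ᗮ → ℝ) (y : (ℝ ∙ ν)ᗮ) :
    hyperplaneProj ν (graphParam ν g y) = y := hyperplaneProj_add_smul ν y (g y)

theorem range_graphParam {ν : V} (hν : ‖ν‖ = 1) (g : (ℝ ∙ ν)ᗮ → ℝ) :
    range (graphParam ν g) = graphOver ν g := by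
  ext x
  constructor
  · rintro ⟨y, rfl⟩
    rw [graphOver, mem_ofPred_eq, hyperplaneProj_graphParam]
    simp [graphParam, inner_add_right, inner_hyperplane, inner_smul_right, hν,
      -Submodule.coe_inner]
  · intro hx
    refine ⟨hyperplaneProj ν x, ?_⟩
    have h : inner ℝ ν x = g (hyperplaneProj ν x) := hx
    rw [graphParam, ← h]
    exact hyperplaneProj_add_inner_smul hν x

theorem isClosed_graphOver {ν : V} {g : (ℝ ∙ ν)ᗮ → ℝ} (hg : Continuous g) :
    IsClosed (graphOver ν g) :=
  isClosed_eq (by fun_prop) (by fun_prop)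

theorem frontier_subgraph {ν : V} (hν : ‖ν‖ = 1) {g : (ℝ ∙ ν)ᗮ → ℝ} (hg : Continuous g) :
    frontier (subgraph ν g) = graphOver ν g := by
  apply (graphCoords hν hg).surjective.preimage_injective
  rw [(graphCoords hν hg).preimage_frontier, graphCoords_preimage_subgraph, frontier_univ_prod_eq,
    frontier_Iio]
  ext ⟨y, t⟩
  simp [graphOver, graphCoords_apply, hyperplaneProj_add_smul, inner_add_right, inner_hyperplane,
    inner_smul_right, hν, -map_add]

theorem injective_graphParam (ν : V) (g : (ℝ ∙ ν)ᗮ → ℝ) : Function.Injective (graphParam ν g) :=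
  Function.LeftInverse.injective (g := hyperplaneProj ν) (hyperplaneProj_graphParam ν g)

theorem hasFDerivAt_graphParam (ν : V) {g : (ℝ ∙ ν)ᗮ → ℝ} (hg : ContDiff ℝ 1 g)
    (y : (ℝ ∙ ν)ᗮ) :
    HasFDerivAt (graphParam ν g) ((ℝ ∙ ν)ᗮ.subtypeL + (fderiv ℝ g y).smulRight ν) y :=
  ((ℝ ∙ ν)ᗮ.subtypeL.hasFDerivAt).add
    ((hg.differentiable one_ne_zero y).hasFDerivAt.smul_const ν)

variable [FiniteDimensional ℝ V]

/-- The upward normal vector `ν - ∇g` of the graph of `g`; its length is the area density. -/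
def graphNormal (ν : V) (g : (ℝ ∙ ν)ᗮ → ℝ) (y : (ℝ ∙ ν)ᗮ) : V :=
  ν - ((gradient g y : (ℝ ∙ ν)ᗮ) : V)

theorem inner_graphNormal (ν : V) (g : (ℝ ∙ ν)ᗮ → ℝ) (y : (ℝ ∙ ν)ᗮ) (e : V) :
    inner ℝ (graphNormal ν g y) e = inner ℝ ν e - fderiv ℝ g y (hyperplaneProj ν e) := by
  rw [graphNormal, inner_sub_left, ← inner_gradient_left,
    ← Submodule.inner_orthogonalProjectionOnto_eq_of_mem_left]

theorem norm_sq_graphNormal {ν : V} (hν : ‖ν‖ = 1) (g : (ℝ ∙ ν)ᗮ → ℝ) (y : (ℝ ∙ ν)ᗮ) :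
    ‖graphNormal ν g y‖ ^ 2 = 1 + ‖gradient g y‖ ^ 2 := by
  rw [graphNormal, norm_sub_sq_real, inner_hyperplane, hν]
  simp

theorem norm_graphNormal_pos {ν : V} (hν : ‖ν‖ = 1) (g : (ℝ ∙ ν)ᗮ → ℝ) (y : (ℝ ∙ ν)ᗮ) :
    0 < ‖graphNormal ν g y‖ := by
  have h := norm_sq_graphNormal hν g y
  have : ‖graphNormal ν g y‖ ≠ 0 := by
    intro h0
    rw [h0] at h
    nlinarith [sq_nonneg ‖gradient g y‖]
  positivity

theorem continuous_graphNormal (ν : V) {g : (ℝ ∙ ν)ᗮ → ℝ} (hg : ContDiff ℝ 1 g) :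
    Continuous (graphNormal ν g) := by
  have : Continuous (gradient g) :=
    (InnerProductSpace.toDual ℝ _).symm.continuous.comp (hg.continuous_fderiv one_ne_zero)
  exact continuous_const.sub (continuous_subtype_val.comp this)

theorem normDet_fderiv_graphParam {ν : V} (hν : ‖ν‖ = 1) {g : (ℝ ∙ ν)ᗮ → ℝ}
    (hg : ContDiff ℝ 1 g) (y : (ℝ ∙ ν)ᗮ) :
    (fderiv ℝ (graphParam ν g) y).toLinearMap.normDet = ‖graphNormal ν g y‖ := by
  rw [← sq_eq_sq₀ (LinearMap.normDet_nonneg _) (norm_nonneg _), norm_sq_graphNormal hν]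
  set b := stdOrthonormalBasis ℝ (ℝ ∙ ν)ᗮ
  have h1 := LinearMap.normDet_sq_eq_det_gram (fderiv ℝ (graphParam ν g) y).toLinearMap b
  set u : Fin (Module.finrank ℝ (ℝ ∙ ν)ᗮ) → ℝ := fun i => fderiv ℝ g y (b i) with hu
  -- the Gram matrix is the identity plus the rank one matrix `u uᵀ`
  have h2 : Matrix.gram ℝ (fun i => (fderiv ℝ (graphParam ν g) y).toLinearMap (b i))
      = 1 + Matrix.replicateCol Unit u * Matrix.replicateRow Unit u := by
    ext i j
    rw [Matrix.gram_apply, (hasFDerivAt_graphParam ν hg y).fderiv]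
    have hb : inner ℝ ((b i : V)) (b j : V) = if i = j then (1 : ℝ) else 0 :=
      orthonormal_iff_ite.1 b.orthonormal i j
    have hb1 : inner ℝ ((b i : V)) ν = (0 : ℝ) := by
      rw [real_inner_comm]; exact inner_hyperplane ν _
    simp only [ContinuousLinearMap.coe_coe, add_apply, Submodule.subtypeL_apply,
      ContinuousLinearMap.smulRight_apply, inner_add_left, inner_add_right, inner_smul_left,
      inner_smul_right, hb, hb1, inner_hyperplane, real_inner_self_eq_norm_sq, hν]
    simp [Matrix.one_apply, Matrix.mul_apply, hu, mul_comm]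
  rw [h2, Matrix.det_one_add_replicateCol_mul_replicateRow] at h1
  have h3 : u ⬝ᵥ u = ‖gradient g y‖ ^ 2 := by
    rw [← b.sum_sq_inner_right, dotProduct]
    refine Finset.sum_congr rfl fun i _ => ?_
    rw [← sq, hu, real_inner_comm]
    congr 1
    exact (inner_gradient_left ..).symm
  rw [h3] at h1
  simpa using h1

variable [MeasurableSpace V] [BorelSpace V]

/-- Surface integrals over a graph, in the coordinate of the graph. -/
theorem restrict_graphOver_eq_map {ν : V} (hν : ‖ν‖ = 1) {g : (ℝ ∙ ν)ᗮ → ℝ}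
    (hg : ContDiff ℝ 1 g) :
    (μHE[Module.finrank ℝ (ℝ ∙ ν)ᗮ] : Measure V).restrict (graphOver ν g)
      = (volume.withDensity fun y => ENNReal.ofReal ‖graphNormal ν g y‖).map
          (graphParam ν g) := by
  have hd : ContDiff ℝ 1 (graphParam ν g) := by
    have : graphParam ν g = fun y => (ℝ ∙ ν)ᗮ.subtypeL y + g y • ν := rfl
    rw [this]
    fun_prop
  have himm : ∀ y, Function.Injective (fderiv ℝ (graphParam ν g) y) := by
    intro y
    have h := (LinearMap.normDet_ne_zero_tfae
      (fderiv ℝ (graphParam ν g) y).toLinearMap).out 0 4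
    refine h.1 ?_
    rw [normDet_fderiv_graphParam hν hg]
    exact (norm_graphNormal_pos hν g y).ne'
  have h := comap_euclideanHausdorffMeasure hd (injective_graphParam ν g) himm
  simp only [normDet_fderiv_graphParam hν hg] at h
  rw [← h, (hd.continuous.measurableEmbedding (injective_graphParam ν g)).map_comap,
    range_graphParam hν]

theorem setIntegral_graphOver {ν : V} (hν : ‖ν‖ = 1) {g : (ℝ ∙ ν)ᗮ → ℝ}
    (hg : ContDiff ℝ 1 g) (F : V → ℝ) :
    ∫ x in graphOver ν g, F x ∂μHE[Module.finrank ℝ (ℝ ∙ ν)ᗮ]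
      = ∫ y, ‖graphNormal ν g y‖ * F (graphParam ν g y) := by
  have hc : Continuous (graphParam ν g) :=
    continuous_subtype_val.add (hg.continuous.smul continuous_const)
  rw [restrict_graphOver_eq_map hν hg,
    (hc.measurableEmbedding (injective_graphParam ν g)).integral_map,
    integral_withDensity_eq_integral_toReal_smul]
  · simp
  · exact (continuous_graphNormal ν hg).norm.measurable.ennreal_ofReal
  · simp

theorem measure_graphOver_inter_ball_lt_top {ν : V} (hν : ‖ν‖ = 1) {g : (ℝ ∙ ν)ᗮ → ℝ}
    (hg : ContDiff ℝ 1 g) (p : V) (r : ℝ) :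
    μHE[Module.finrank ℝ (ℝ ∙ ν)ᗮ] (graphOver ν g ∩ Metric.ball p r) < ⊤ := by
  have hc : Continuous (graphParam ν g) :=
    continuous_subtype_val.add (hg.continuous.smul continuous_const)
  rw [inter_comm, ← Measure.restrict_apply Metric.isOpen_ball.measurableSet,
    restrict_graphOver_eq_map hν hg, Measure.map_apply hc.measurable
    Metric.isOpen_ball.measurableSet, withDensity_apply _
    (Metric.isOpen_ball.measurableSet.preimage hc.measurable)]
  set K := Metric.closedBall (hyperplaneProj ν p) (‖hyperplaneProj ν‖ * r) with hK
  have hsub : graphParam ν g ⁻¹' Metric.ball p r ⊆ K := by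
    intro y hy
    rw [hK, mem_closedBall_iff_norm, ← hyperplaneProj_graphParam ν g y, ← map_sub]
    exact (ContinuousLinearMap.le_opNorm _ _).trans
      (mul_le_mul_of_nonneg_left (mem_ball_iff_norm.1 hy).le (norm_nonneg _))
  refine (lintegral_mono_set hsub).trans_lt ?_
  have hi : IntegrableOn (fun y => ‖graphNormal ν g y‖) K :=
    (continuous_graphNormal ν hg).norm.continuousOn.integrableOn_compact
      (isCompact_closedBall _ _)
  have := hi.hasFiniteIntegral
  simpa [HasFiniteIntegral, ← ofReal_norm] using this

end GraphSurface

variable {d : ℕ}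

/-! ### The boundary of a `C²` domain and its outward normal -/

theorem finrank_hyperplane {ν : E d} (hν : ‖ν‖ = 1) : Module.finrank ℝ (ℝ ∙ ν)ᗮ = d - 1 := by
  have h := (ℝ ∙ ν).finrank_add_finrank_orthogonal
  rw [finrank_span_singleton (by rintro rfl; simp at hν), finrank_euclideanSpace_fin] at h
  omega

/-- The function `γ` of the definition, constant in the direction `ν`, is replaced by its
restriction to `ν^⊥`. -/
theorem IsBoundedC2Domain.exists_subgraph {Ω : Set (E d)} (hΩ : IsBoundedC2Domain Ω) {p : E d}
    (hp : p ∈ frontier Ω) : ∃ r > 0, ∃ ν : E d, ‖ν‖ = 1 ∧ ∃ g : (ℝ ∙ ν)ᗮ → ℝ, ContDiff ℝ 1 g ∧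
      Ω ∩ Metric.ball p r = subgraph ν g ∩ Metric.ball p r := by
  obtain ⟨r, hr, ν, γ, hν, hγ, hinv, hΩr⟩ := hΩ.boundary p hp
  refine ⟨r, hr, ν, hν, fun y => γ y, ?_, ?_⟩
  · exact (hγ.of_le (by norm_num)).comp (ℝ ∙ ν)ᗮ.subtypeL.contDiff
  · rw [hΩr]
    ext x
    have hx : γ (hyperplaneProj ν x : E d) = γ x := by
      conv_rhs => rw [← hyperplaneProj_add_inner_smul hν x, hinv]
    simp only [subgraph, mem_inter_iff, mem_ofPred_eq, hx]
    exact and_comm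

theorem frontier_inter_ball_eq {Ω : Set (E d)} {p ν : E d} {r : ℝ} (hν : ‖ν‖ = 1)
    {g : (ℝ ∙ ν)ᗮ → ℝ} (hg : Continuous g)
    (h : Ω ∩ Metric.ball p r = subgraph ν g ∩ Metric.ball p r) :
    frontier Ω ∩ Metric.ball p r = graphOver ν g ∩ Metric.ball p r := by
  rw [← frontier_inter_open_inter Metric.isOpen_ball, h,
    frontier_inter_open_inter Metric.isOpen_ball, frontier_subgraph hν hg]

theorem isOutwardUnitNormal_graphNormal {Ω : Set (E d)} {p ν : E d} {r : ℝ} (hν : ‖ν‖ = 1)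
    {g : (ℝ ∙ ν)ᗮ → ℝ} (hg : ContDiff ℝ 1 g)
    (h : Ω ∩ Metric.ball p r = subgraph ν g ∩ Metric.ball p r) {x : E d}
    (hx : x ∈ graphOver ν g ∩ Metric.ball p r) :
    IsOutwardUnitNormal Ω x
      (‖graphNormal ν g (hyperplaneProj ν x)‖⁻¹ • graphNormal ν g (hyperplaneProj ν x)) := by
  set N := graphNormal ν g (hyperplaneProj ν x) with hN
  have hN0 : 0 < ‖N‖ := norm_graphNormal_pos hν g _
  refine ⟨by rw [norm_smul, norm_inv, norm_norm, inv_mul_cancel₀ hN0.ne'],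
    fun z => inner ℝ ν z - g (hyperplaneProj ν z), ‖N‖, hN0, ?_, ?_, ?_, ?_⟩
  · exact (((innerSL ℝ ν).contDiff).sub (hg.comp (hyperplaneProj ν).contDiff)).contDiffAt
  · exact sub_eq_zero.2 hx.1
  · rw [smul_inv_smul₀ hN0.ne', hasGradientAt_iff_hasFDerivAt]
    have h1 : HasFDerivAt (fun z => inner ℝ ν z - g (hyperplaneProj ν z))
        (innerSL ℝ ν - fderiv ℝ g (hyperplaneProj ν x) ∘L hyperplaneProj ν) x :=
      (innerSL ℝ ν).hasFDerivAt.sub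
        ((hg.differentiable one_ne_zero _).hasFDerivAt.comp x (hyperplaneProj ν).hasFDerivAt)
    refine h1.congr_fderiv ?_
    ext e
    simp [hN, inner_graphNormal]
  · filter_upwards [Metric.isOpen_ball.mem_nhds hx.2] with y hy
    have h1 : y ∈ Ω ∩ Metric.ball p r ↔ y ∈ subgraph ν g ∩ Metric.ball p r := by rw [h]
    simp only [mem_inter_iff, hy, and_true] at h1
    rw [h1, subgraph, mem_ofPred_eq, sub_neg]

theorem eventually_pos_smul_of_hasGradientAt {ρ : E d → ℝ} {x a v : E d}
    (h : HasGradientAt ρ a x) (h0 : ρ x = 0) (hv : 0 < (inner ℝ a v : ℝ)) :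
    ∀ᶠ t : ℝ in 𝓝[>] 0, 0 < ρ (x + t • v) := by
  have h1 : HasDerivAt (fun t : ℝ => ρ (x + t • v)) (inner ℝ a v : ℝ) 0 := by
    have hl : HasDerivAt (fun t : ℝ => x + t • v) v 0 := by
      simpa using ((hasDerivAt_id (0 : ℝ)).smul_const v).const_add x
    have h2 : HasFDerivAt ρ (InnerProductSpace.toDual ℝ (E d) a) (x + (0 : ℝ) • v) := by
      simpa using h.hasFDerivAt
    have h3 := h2.comp_hasDerivAt (0 : ℝ) hl
    rwa [InnerProductSpace.toDual_apply_apply] at h3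
  have h2 := (hasDerivAt_iff_tendsto_slope.1 h1).eventually_const_lt hv
  have h3 : ∀ᶠ t : ℝ in 𝓝[>] 0, 0 < slope (fun t : ℝ => ρ (x + t • v)) 0 t :=
    h2.filter_mono (nhdsWithin_mono _ fun t (ht : 0 < t) => ht.ne')
  filter_upwards [h3, self_mem_nhdsWithin] with t ht ht0
  rw [slope_def_field] at ht
  simp only [zero_smul, add_zero, h0, sub_zero] at ht
  exact (div_pos_iff_of_pos_right ht0).1 ht

theorem IsOutwardUnitNormal.unique {Ω : Set (E d)} {x n n' : E d}
    (h : IsOutwardUnitNormal Ω x n) (h' : IsOutwardUnitNormal Ω x n') : n = n' := by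
  obtain ⟨hn, ρ, c, hc, -, h0, hgrad, hΩ⟩ := h
  obtain ⟨hn', ρ', c', hc', -, h0', hgrad', hΩ'⟩ := h'
  by_contra hne
  have hlt : (inner ℝ n n' : ℝ) < 1 := (inner_lt_one_iff_real_of_norm_eq_one hn hn').2 hne
  -- moving in direction `n' - n` enters `Ω` according to `ρ` and leaves it according to `ρ'`
  have hpos' : 0 < (inner ℝ (c' • n') (n' - n) : ℝ) := by
    rw [inner_smul_left, inner_sub_right, real_inner_self_eq_norm_sq, hn', real_inner_comm]
    simp only [conj_trivial]
    nlinarith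
  have hgneg : HasGradientAt (fun z => -ρ z) (-(c • n)) x := by
    rw [hasGradientAt_iff_hasFDerivAt, map_neg]
    exact hgrad.hasFDerivAt.neg
  have hpos : 0 < (inner ℝ (-(c • n)) (n' - n) : ℝ) := by
    rw [inner_neg_left, inner_smul_left, inner_sub_right, real_inner_self_eq_norm_sq, hn]
    simp only [conj_trivial]
    nlinarith
  have e1 := eventually_pos_smul_of_hasGradientAt hgneg (by simp [h0]) hpos
  have e2 := eventually_pos_smul_of_hasGradientAt hgrad' h0' hpos'
  have hl : Tendsto (fun t : ℝ => x + t • (n' - n)) (𝓝[>] 0) (𝓝 x) := by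
    have : Tendsto (fun t : ℝ => x + t • (n' - n)) (𝓝 0) (𝓝 (x + (0 : ℝ) • (n' - n))) :=
      Continuous.tendsto (by fun_prop) 0
    rw [zero_smul, add_zero] at this
    exact this.mono_left nhdsWithin_le_nhds
  obtain ⟨t, ht1, ht2, ht3, ht4⟩ :=
    (e1.and (e2.and ((hl.eventually hΩ).and (hl.eventually hΩ')))).exists
  have := ht4.1 (ht3.2 (neg_pos.1 ht1))
  linarith

theorem IsOutwardUnitNormal.outwardNormal_eq {Ω : Set (E d)} {x n : E d}
    (h : IsOutwardUnitNormal Ω x n) : outwardNormal Ω x = n := by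
  have hex : ∃ n, IsOutwardUnitNormal Ω x n := ⟨n, h⟩
  rw [outwardNormal, dif_pos hex]
  exact hex.choose_spec.unique h

theorem norm_outwardNormal_le_one (Ω : Set (E d)) (x : E d) : ‖outwardNormal Ω x‖ ≤ 1 := by
  rw [outwardNormal]
  split_ifs with h
  · exact h.choose_spec.1.le
  · simp

theorem IsBoundedC2Domain.continuousOn_outwardNormal {Ω : Set (E d)}
    (hΩ : IsBoundedC2Domain Ω) : ContinuousOn (outwardNormal Ω) (frontier Ω) := by
  intro p hp
  obtain ⟨r, hr, ν, hν, g, hg, h⟩ := hΩ.exists_subgraph hp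
  have hball : Metric.ball p r ∈ 𝓝 p := Metric.ball_mem_nhds p hr
  have hc : Continuous fun x => ‖graphNormal ν g (hyperplaneProj ν x)‖⁻¹
      • graphNormal ν g (hyperplaneProj ν x) := by
    have h1 := (continuous_graphNormal ν hg).comp (hyperplaneProj ν).continuous
    exact (h1.norm.inv₀ fun x => (norm_graphNormal_pos hν g _).ne').smul h1
  have heq : ∀ x ∈ frontier Ω ∩ Metric.ball p r, outwardNormal Ω x
      = ‖graphNormal ν g (hyperplaneProj ν x)‖⁻¹ • graphNormal ν g (hyperplaneProj ν x) := by
    intro x hx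
    rw [frontier_inter_ball_eq hν hg.continuous h] at hx
    exact (isOutwardUnitNormal_graphNormal hν hg h hx).outwardNormal_eq
  refine ContinuousWithinAt.congr_of_eventuallyEq hc.continuousWithinAt ?_
    (heq p ⟨hp, Metric.mem_ball_self hr⟩)
  filter_upwards [self_mem_nhdsWithin, mem_nhdsWithin_of_mem_nhds hball] with x hx hxb
  exact heq x ⟨hx, hxb⟩

theorem IsBoundedC2Domain.isCompact_closure {Ω : Set (E d)} (hΩ : IsBoundedC2Domain Ω) :
    IsCompact (closure Ω) := hΩ.isBounded.isCompact_closure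

theorem IsBoundedC2Domain.isFiniteMeasure_bulkMeasure {Ω : Set (E d)}
    (hΩ : IsBoundedC2Domain Ω) : IsFiniteMeasure (bulkMeasure Ω) :=
  ⟨by rw [bulkMeasure, Measure.restrict_apply_univ]; exact hΩ.isBounded.measure_lt_top⟩

theorem IsBoundedC2Domain.isFiniteMeasure_surfaceMeasure {Ω : Set (E d)}
    (hΩ : IsBoundedC2Domain Ω) : IsFiniteMeasure (surfaceMeasure Ω) := by
  refine ⟨?_⟩
  rw [surfaceMeasure, Measure.restrict_apply_univ]
  have hK : IsCompact (frontier Ω) :=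
    hΩ.isCompact_closure.of_isClosed_subset isClosed_frontier frontier_subset_closure
  refine hK.measure_lt_top_of_nhdsWithin fun p hp => ?_
  obtain ⟨r, hr, ν, hν, g, hg, h⟩ := hΩ.exists_subgraph hp
  refine ⟨frontier Ω ∩ Metric.ball p r, inter_mem_nhdsWithin _ (Metric.ball_mem_nhds p hr), ?_⟩
  rw [frontier_inter_ball_eq hν hg.continuous h, ← finrank_hyperplane hν]
  exact measure_graphOver_inter_ball_lt_top hν hg p r

theorem IsBoundedC2Domain.aestronglyMeasurable_outwardNormal {Ω : Set (E d)}
    (hΩ : IsBoundedC2Domain Ω) : AEStronglyMeasurable (outwardNormal Ω) (surfaceMeasure Ω) :=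
  hΩ.continuousOn_outwardNormal.aestronglyMeasurable isClosed_frontier.measurableSet

/-! ### The divergence theorem -/

/-- The Gauss-Green formula for functions supported where the domain is a subgraph. -/
theorem gaussGreen_of_tsupport_subset_ball {Ω : Set (E d)} (hΩ : IsOpen Ω) {p ν : E d} {r : ℝ}
    (hν : ‖ν‖ = 1) {g : (ℝ ∙ ν)ᗮ → ℝ} (hg : ContDiff ℝ 1 g)
    (h : Ω ∩ Metric.ball p r = subgraph ν g ∩ Metric.ball p r) {w : E d → ℝ}
    (hw : ContDiff ℝ 1 w) (hc : HasCompactSupport w) (hs : tsupport w ⊆ Metric.ball p r)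
    (e : E d) :
    ∫ x, fderiv ℝ w x e ∂bulkMeasure Ω
      = ∫ x, w x * inner ℝ (outwardNormal Ω x) e ∂surfaceMeasure Ω := by
  have hw0 : ∀ x, x ∉ Metric.ball p r → w x = 0 := fun x hx =>
    image_eq_zero_of_notMem_tsupport fun hx' => hx (hs hx')
  have hdw0 : ∀ x, x ∉ Metric.ball p r → fderiv ℝ w x = 0 := fun x hx =>
    image_eq_zero_of_notMem_tsupport fun hx' => hx (hs (tsupport_fderiv_subset ℝ hx'))
  -- for functions supported in the ball only the traces of the sets on the ball matter
  have hind : ∀ (A B : Set (E d)) (F : E d → ℝ),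
      A ∩ Metric.ball p r = B ∩ Metric.ball p r → (∀ x, x ∉ Metric.ball p r → F x = 0) →
      A.indicator F = B.indicator F := by
    intro A B F hAB hF
    ext x
    by_cases hx : x ∈ Metric.ball p r
    · have hiff : x ∈ A ∩ Metric.ball p r ↔ x ∈ B ∩ Metric.ball p r := by rw [hAB]
      simp only [mem_inter_iff, hx, and_true] at hiff
      by_cases hB : x ∈ B
      · rw [indicator_of_mem (hiff.2 hB), indicator_of_mem hB]
      · rw [indicator_of_notMem (hiff.not.2 hB), indicator_of_notMem hB]
    · rw [indicator_apply_eq_zero.2 fun _ => hF x hx, indicator_apply_eq_zero.2 fun _ => hF x hx]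
  have hfr := frontier_inter_ball_eq hν hg.continuous h
  have hsub : MeasurableSet (subgraph ν g) :=
    (isOpen_lt (by fun_prop) (by have := hg.continuous; fun_prop)).measurableSet
  calc ∫ x, fderiv ℝ w x e ∂bulkMeasure Ω
      = ∫ x in subgraph ν g, fderiv ℝ w x e := by
        rw [bulkMeasure, ← integral_indicator hΩ.measurableSet, ← integral_indicator hsub,
          hind _ _ _ h fun x hx => by rw [hdw0 x hx, zero_apply]]
    _ = ∫ y : (ℝ ∙ ν)ᗮ, ‖graphNormal ν g y‖ * (w (graphParam ν g y)
          * inner ℝ (outwardNormal Ω (graphParam ν g y)) e) := by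
        rw [integral_fderiv_subgraph hν hg hw hc]
        refine integral_congr_ae (Eventually.of_forall fun y => ?_)
        beta_reduce
        rw [← inner_graphNormal]
        by_cases hy : graphParam ν g y ∈ Metric.ball p r
        · have hmem : graphParam ν g y ∈ graphOver ν g ∩ Metric.ball p r :=
            ⟨range_graphParam hν g ▸ mem_range_self y, hy⟩
          rw [(isOutwardUnitNormal_graphNormal hν hg h hmem).outwardNormal_eq,
            hyperplaneProj_graphParam, inner_smul_left]
          have := (norm_graphNormal_pos hν g y).ne'
          simp only [conj_trivial, graphParam]
          field_simp
        · have h0 := hw0 _ hy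
          rw [h0]
          rw [graphParam] at h0
          rw [h0]
          simp
    _ = ∫ x in graphOver ν g, w x * inner ℝ (outwardNormal Ω x) e
          ∂Measure.euclideanHausdorffMeasure (d - 1) := by
        rw [← finrank_hyperplane hν]
        exact (setIntegral_graphOver hν hg fun x => w x * inner ℝ (outwardNormal Ω x) e).symm
    _ = _ := by
        rw [surfaceMeasure, ← integral_indicator isClosed_frontier.measurableSet,
          ← integral_indicator (isClosed_graphOver hg.continuous).measurableSet,
          hind _ _ _ hfr fun x hx => by rw [hw0 x hx, zero_mul]]

/-- The Gauss-Green formula for functions supported inside the domain: both sides vanish. -/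
theorem gaussGreen_of_tsupport_subset {Ω : Set (E d)} (hΩ : IsOpen Ω) {w : E d → ℝ}
    (hw : ContDiff ℝ 1 w) (hc : HasCompactSupport w) (hs : tsupport w ⊆ Ω) (e : E d) :
    ∫ x, fderiv ℝ w x e ∂bulkMeasure Ω
      = ∫ x, w x * inner ℝ (outwardNormal Ω x) e ∂surfaceMeasure Ω := by
  have h1 : ∫ x, fderiv ℝ w x e ∂bulkMeasure Ω = 0 := by
    rw [← integral_fderiv_apply_eq_zero hw hc e, bulkMeasure]
    refine setIntegral_eq_integral_of_forall_compl_eq_zero fun x hx => ?_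
    rw [image_eq_zero_of_notMem_tsupport fun hx' => hx (hs (tsupport_fderiv_subset ℝ hx')),
      zero_apply]
  rw [h1, surfaceMeasure]
  refine (setIntegral_eq_zero_of_forall_eq_zero fun x hx => ?_).symm
  rw [hΩ.frontier_eq] at hx
  rw [image_eq_zero_of_notMem_tsupport fun hx' => hx.2 (hs hx'), zero_mul]

theorem IsBoundedC2Domain.integrable_mul_inner_outwardNormal {Ω : Set (E d)}
    (hΩ : IsBoundedC2Domain Ω) {w : E d → ℝ} (hw : Continuous w) (hc : HasCompactSupport w)
    (e : E d) : Integrable (fun x => w x * inner ℝ (outwardNormal Ω x) e) (surfaceMeasure Ω) := by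
  have := hΩ.isFiniteMeasure_surfaceMeasure
  obtain ⟨C, hC⟩ := hc.exists_bound_of_continuous hw
  refine Integrable.of_bound (C := C * ‖e‖) (hw.aestronglyMeasurable.mul
    (hΩ.aestronglyMeasurable_outwardNormal.inner aestronglyMeasurable_const))
    (Eventually.of_forall fun x => ?_)
  rw [norm_mul]
  have h1 : ‖(inner ℝ (outwardNormal Ω x) e : ℝ)‖ ≤ ‖e‖ := (norm_inner_le_norm _ _).trans
    (mul_le_of_le_one_left (norm_nonneg _) (norm_outwardNormal_le_one Ω x))
  exact mul_le_mul (hC x) h1 (norm_nonneg _) ((norm_nonneg _).trans (hC x))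

/-- **Gauss-Green formula** on a bounded `C²` domain. It is localised by repeatedly splitting
`w = w f + w (1 - f)` with bump functions `f`, until nothing is left near the closure of `Ω`. -/
theorem IsBoundedC2Domain.gaussGreen {Ω : Set (E d)} (hΩ : IsBoundedC2Domain Ω) {w : E d → ℝ}
    (hw : ContDiff ℝ 1 w) (hc : HasCompactSupport w) (e : E d) :
    ∫ x, fderiv ℝ w x e ∂bulkMeasure Ω
      = ∫ x, w x * inner ℝ (outwardNormal Ω x) e ∂surfaceMeasure Ω := by
  let GG : (E d → ℝ) → Prop := fun w => ∫ x, fderiv ℝ w x e ∂bulkMeasure Ω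
    = ∫ x, w x * inner ℝ (outwardNormal Ω x) e ∂surfaceMeasure Ω
  have hloc : ∀ p : closure Ω, ∃ r > 0, ∀ w : E d → ℝ, ContDiff ℝ 1 w → HasCompactSupport w →
      tsupport w ⊆ Metric.ball (p : E d) r → GG w := by
    rintro ⟨p, hp⟩
    by_cases hpΩ : p ∈ Ω
    · obtain ⟨r, hr, hball⟩ := Metric.isOpen_iff.1 hΩ.isOpen p hpΩ
      exact ⟨r, hr, fun w hw hc hs =>
        gaussGreen_of_tsupport_subset hΩ.isOpen hw hc (hs.trans hball) e⟩
    · obtain ⟨r, hr, ν, hν, g, hg, h⟩ :=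
        hΩ.exists_subgraph (p := p) (by rw [hΩ.isOpen.frontier_eq]; exact ⟨hp, hpΩ⟩)
      exact ⟨r, hr, fun w hw hc hs =>
        gaussGreen_of_tsupport_subset_ball hΩ.isOpen hν hg h hw hc hs e⟩
  choose r hr hGG using hloc
  let f : ∀ p : closure Ω, ContDiffBump (p : E d) := fun p =>
    ⟨r p / 4, r p / 2, by linarith [hr p], by linarith [hr p]⟩
  have hfd : ∀ p, ContDiff ℝ 1 (f p : E d → ℝ) := fun p => (f p).contDiff
  have hfs : ∀ p, tsupport (f p : E d → ℝ) ⊆ Metric.ball (p : E d) (r p) := fun p => by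
    rw [(f p).tsupport_eq]
    exact Metric.closedBall_subset_ball (show r p / 2 < r p by linarith [hr p])
  have hadd : ∀ w₁ w₂ : E d → ℝ, ContDiff ℝ 1 w₁ → HasCompactSupport w₁ → ContDiff ℝ 1 w₂ →
      HasCompactSupport w₂ → GG w₁ → GG w₂ → GG (fun x => w₁ x + w₂ x) := by
    intro w₁ w₂ hw₁ hc₁ hw₂ hc₂ h₁ h₂
    have hi : ∀ w : E d → ℝ, ContDiff ℝ 1 w → HasCompactSupport w →
        Integrable (fun x => fderiv ℝ w x e) (bulkMeasure Ω) := fun w hw hc =>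
      (((hw.continuous_fderiv one_ne_zero).clm_apply
        continuous_const).integrable_of_hasCompactSupport (hc.fderiv_apply ℝ e)).integrableOn
    have hsum : ∀ x, fderiv ℝ (fun x => w₁ x + w₂ x) x e = fderiv ℝ w₁ x e + fderiv ℝ w₂ x e :=
      fun x => by
        rw [fderiv_fun_add (hw₁.differentiable one_ne_zero x) (hw₂.differentiable one_ne_zero x),
          add_apply]
    simp only [GG, hsum, add_mul] at *
    rw [integral_add (hi _ hw₁ hc₁) (hi _ hw₂ hc₂), h₁, h₂,
      integral_add (hΩ.integrable_mul_inner_outwardNormal hw₁.continuous hc₁ e)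
        (hΩ.integrable_mul_inner_outwardNormal hw₂.continuous hc₂ e)]
  -- each `w * f p` satisfies the formula, so `w` may be replaced by `w * ∏ (1 - f p)`
  have hprod : ∀ (s : Finset (closure Ω)) (w : E d → ℝ), ContDiff ℝ 1 w → HasCompactSupport w →
      GG (fun x => w x * ∏ p ∈ s, (1 - f p x)) → GG w := by
    classical
    intro s
    induction s using Finset.induction with
    | empty => intro w _ _ h; simpa using h
    | insert p s hp ih =>
      intro w hw hc h
      have h1 : GG (fun x => w x * (1 - f p x)) := by
        refine ih _ (hw.mul (contDiff_const.sub (hfd p))) hc.mul_right ?_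
        simpa only [Finset.prod_insert hp, mul_assoc] using h
      have h2 : GG (fun x => w x * f p x) :=
        hGG p _ (hw.mul (hfd p)) hc.mul_right ((tsupport_mul_subset_right).trans (hfs p))
      have h3 := hadd _ _ (hw.mul (hfd p)) hc.mul_right (hw.mul (contDiff_const.sub (hfd p)))
        hc.mul_right h2 h1
      convert h3 using 1
      ext x
      ring
  obtain ⟨t, ht⟩ := hΩ.isCompact_closure.elim_finite_subcover
    (fun p : closure Ω => Metric.ball (p : E d) (r p / 4)) (fun p => Metric.isOpen_ball)
    fun x hx => mem_iUnion.2 ⟨⟨x, hx⟩, Metric.mem_ball_self (by linarith [hr ⟨x, hx⟩])⟩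
  refine hprod t w hw hc ?_
  have hzero : ∀ x ∈ ⋃ p ∈ t, Metric.ball (p : E d) (r p / 4),
      w x * ∏ p ∈ t, (1 - f p x) = 0 := by
    intro x hx
    obtain ⟨p, hpt, hxp⟩ := mem_iUnion₂.1 hx
    rw [Finset.prod_eq_zero hpt, mul_zero]
    rw [(f p).one_of_mem_closedBall (Metric.ball_subset_closedBall hxp), sub_self]
  have hopen : IsOpen (⋃ p ∈ t, Metric.ball (p : E d) (r p / 4)) :=
    isOpen_biUnion fun p _ => Metric.isOpen_ball
  have hl : ∫ x, fderiv ℝ (fun x => w x * ∏ p ∈ t, (1 - f p x)) x e ∂bulkMeasure Ω = 0 := by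
    refine setIntegral_eq_zero_of_forall_eq_zero fun x hx => ?_
    have : (fun x => w x * ∏ p ∈ t, (1 - f p x)) =ᶠ[𝓝 x] fun _ => (0 : ℝ) := by
      filter_upwards [hopen.mem_nhds (ht (subset_closure hx))] with y hy using hzero y hy
    rw [this.fderiv_eq]
    simp
  have hr0 : ∫ x, (w x * ∏ p ∈ t, (1 - f p x)) * inner ℝ (outwardNormal Ω x) e
      ∂surfaceMeasure Ω = 0 := by
    refine setIntegral_eq_zero_of_forall_eq_zero fun x hx => ?_
    rw [hzero x (ht (frontier_subset_closure hx)), zero_mul]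
  exact hl.trans hr0.symm

/-! ### Limits of products in `L²` -/

section L2Limits

variable {X F : Type*} [MeasurableSpace X] {μ : Measure X} [NormedAddCommGroup F]

theorem tendsto_integral_inner_of_tendsto_eLpNorm [InnerProductSpace ℝ F] {a b : ℕ → X → F}
    {u v : X → F}
    (ha : ∀ k, MemLp (a k) 2 μ) (hb : ∀ k, MemLp (b k) 2 μ) (hu : MemLp u 2 μ) (hv : MemLp v 2 μ)
    (hau : Tendsto (fun k => eLpNorm (fun x => a k x - u x) 2 μ) atTop (𝓝 0))
    (hbv : Tendsto (fun k => eLpNorm (fun x => b k x - v x) 2 μ) atTop (𝓝 0)) :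
    Tendsto (fun k => ∫ x, (inner ℝ (a k x) (b k x) : ℝ) ∂μ) atTop
      (𝓝 (∫ x, (inner ℝ (u x) (v x) : ℝ) ∂μ)) := by
  have h1 := (Lp.tendsto_Lp_iff_tendsto_eLpNorm'' a ha u hu).2 hau
  have h2 := (Lp.tendsto_Lp_iff_tendsto_eLpNorm'' b hb v hv).2 hbv
  have key : ∀ {p q : X → F} (hp : MemLp p 2 μ) (hq : MemLp q 2 μ),
      ∫ x, (inner ℝ (p x) (q x) : ℝ) ∂μ = inner ℝ (hp.toLp p) (hq.toLp q) := by
    intro p q hp hq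
    rw [L2.inner_def]
    refine integral_congr_ae ?_
    filter_upwards [hp.coeFn_toLp, hq.coeFn_toLp] with x h1 h2
    rw [h1, h2]
  rw [key hu hv]
  simp only [key (ha _) (hb _)]
  exact h1.inner h2

theorem tendsto_integral_mul_of_tendsto_eLpNorm {a b : ℕ → X → ℝ} {u v : X → ℝ}
    (ha : ∀ k, MemLp (a k) 2 μ) (hb : ∀ k, MemLp (b k) 2 μ) (hu : MemLp u 2 μ) (hv : MemLp v 2 μ)
    (hau : Tendsto (fun k => eLpNorm (fun x => a k x - u x) 2 μ) atTop (𝓝 0))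
    (hbv : Tendsto (fun k => eLpNorm (fun x => b k x - v x) 2 μ) atTop (𝓝 0)) :
    Tendsto (fun k => ∫ x, a k x * b k x ∂μ) atTop (𝓝 (∫ x, u x * v x ∂μ)) := by
  have h := tendsto_integral_inner_of_tendsto_eLpNorm hb ha hv hu hbv hau
  simpa [real_inner_comm] using h

theorem tendsto_eLpNorm_sub_sub {a b : ℕ → X → F} {u v : X → F}
    (ha : ∀ k, AEStronglyMeasurable (a k) μ) (hb : ∀ k, AEStronglyMeasurable (b k) μ)
    (hu : AEStronglyMeasurable u μ) (hv : AEStronglyMeasurable v μ)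
    (hau : Tendsto (fun k => eLpNorm (fun x => a k x - u x) 2 μ) atTop (𝓝 0))
    (hbv : Tendsto (fun k => eLpNorm (fun x => b k x - v x) 2 μ) atTop (𝓝 0)) :
    Tendsto (fun k => eLpNorm (fun x => (a k x - b k x) - (u x - v x)) 2 μ) atTop (𝓝 0) := by
  have h := hau.add hbv
  rw [add_zero] at h
  refine tendsto_of_tendsto_of_tendsto_of_le_of_le tendsto_const_nhds h (fun _ => zero_le) ?_
  intro k
  have h1 : (fun x => (a k x - b k x) - (u x - v x))
      = (fun x => a k x - u x) - fun x => b k x - v x := by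
    ext x; simp only [Pi.sub_apply]; abel
  simp only [h1]
  exact eLpNorm_sub_le ((ha k).sub hu) ((hb k).sub hv) (by norm_num)

theorem tendsto_eLpNorm_of_norm_le {G : Type*} [NormedAddCommGroup G] {a : ℕ → X → F}
    {b : ℕ → X → G} (h : ∀ k x, ‖b k x‖ ≤ ‖a k x‖)
    (ha : Tendsto (fun k => eLpNorm (a k) 2 μ) atTop (𝓝 0)) :
    Tendsto (fun k => eLpNorm (b k) 2 μ) atTop (𝓝 0) :=
  tendsto_of_tendsto_of_tendsto_of_le_of_le tendsto_const_nhds ha (fun _ => zero_le)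
    fun k => eLpNorm_mono (h k)

theorem integrable_fun_mul_of_memLp {f g : X → ℝ} (hf : MemLp f 2 μ) (hg : MemLp g 2 μ) :
    Integrable (fun x => f x * g x) μ := hf.integrable_mul hg

theorem integrable_inner_of_memLp [InnerProductSpace ℝ F] {f g : X → F} (hf : MemLp f 2 μ)
    (hg : MemLp g 2 μ) : Integrable (fun x => (inner ℝ (f x) (g x) : ℝ)) μ := by
  refine (hf.norm.integrable_mul hg.norm).mono' (hf.1.inner hg.1)
    (Eventually.of_forall fun x => norm_inner_le_norm _ _)

end L2Limits

/-! ### Test functions -/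

theorem IsTest.contDiff_one {φ : E d → ℝ} (h : IsTest φ) : ContDiff ℝ 1 φ :=
  h.1.of_le (by exact_mod_cast le_top)

theorem IsTest.sub {φ ψ : E d → ℝ} (hφ : IsTest φ) (hψ : IsTest ψ) :
    IsTest fun x => φ x - ψ x :=
  ⟨hφ.1.sub hψ.1, hφ.2.sub hψ.2⟩

theorem IsTest.continuous_gradient {φ : E d → ℝ} (h : IsTest φ) : Continuous (gradient φ) :=
  (InnerProductSpace.toDual ℝ _).symm.continuous.comp
    (h.contDiff_one.continuous_fderiv one_ne_zero)

theorem IsTest.memLp {φ : E d → ℝ} (h : IsTest φ) (μ : Measure (E d)) [IsFiniteMeasure μ] :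
    MemLp φ 2 μ := by
  obtain ⟨C, hC⟩ := h.2.exists_bound_of_continuous h.1.continuous
  exact MemLp.of_bound h.1.continuous.aestronglyMeasurable C (Eventually.of_forall hC)

theorem IsTest.exists_bound_gradient {φ : E d → ℝ} (h : IsTest φ) :
    ∃ C, ∀ x, ‖gradient φ x‖ ≤ C := by
  obtain ⟨C, hC⟩ := (h.2.fderiv ℝ).exists_bound_of_continuous
    (h.contDiff_one.continuous_fderiv one_ne_zero)
  exact ⟨C, fun x => by rw [gradient, LinearIsometryEquiv.norm_map]; exact hC x⟩

theorem IsTest.memLp_gradient {φ : E d → ℝ} (h : IsTest φ) (μ : Measure (E d))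
    [IsFiniteMeasure μ] : MemLp (gradient φ) 2 μ := by
  obtain ⟨C, hC⟩ := h.exists_bound_gradient
  exact MemLp.of_bound h.continuous_gradient.aestronglyMeasurable C (Eventually.of_forall hC)

theorem IsTest.gradient_sub {φ ψ : E d → ℝ} (hφ : IsTest φ) (hψ : IsTest ψ) (x : E d) :
    gradient (fun x => φ x - ψ x) x = gradient φ x - gradient ψ x := by
  rw [gradient, fderiv_fun_sub (hφ.contDiff_one.differentiable one_ne_zero x)
    (hψ.contDiff_one.differentiable one_ne_zero x), map_sub]
  rfl

theorem IsTest.tangentialGradient_sub (Ω : Set (E d)) {φ ψ : E d → ℝ} (hφ : IsTest φ)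
    (hψ : IsTest ψ) (x : E d) : tangentialGradient Ω (fun x => φ x - ψ x) x
      = tangentialGradient Ω φ x - tangentialGradient Ω ψ x := by
  simp only [tangentialGradient, hφ.gradient_sub hψ, inner_sub_left, sub_smul]
  abel

theorem IsTest.memLp_tangentialGradient {Ω : Set (E d)} (hΩ : IsBoundedC2Domain Ω)
    {φ : E d → ℝ} (h : IsTest φ) : MemLp (tangentialGradient Ω φ) 2 (surfaceMeasure Ω) := by
  have := hΩ.isFiniteMeasure_surfaceMeasure
  have hn := hΩ.aestronglyMeasurable_outwardNormal
  have hg : AEStronglyMeasurable (gradient φ) (surfaceMeasure Ω) :=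
    h.continuous_gradient.aestronglyMeasurable
  obtain ⟨C, hC⟩ := h.exists_bound_gradient
  refine (h.memLp_gradient _).sub (MemLp.of_bound (show AEStronglyMeasurable (fun x =>
    (inner ℝ (gradient φ x) (outwardNormal Ω x) : ℝ) • outwardNormal Ω x) _ from
    (hg.inner (𝕜 := ℝ) hn).smul hn) C (Eventually.of_forall fun x => ?_))
  rw [norm_smul]
  have hn1 := norm_outwardNormal_le_one Ω x
  have h1 : ‖(inner ℝ (gradient φ x) (outwardNormal Ω x) : ℝ)‖ ≤ C :=
    (norm_inner_le_norm _ _).trans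
      ((mul_le_of_le_one_right (norm_nonneg _) hn1).trans (hC x))
  exact (mul_le_of_le_one_right (norm_nonneg _) hn1).trans h1

/-! ### Differences of traces and of surface gradients -/

theorem HasTrace.sub {Ω : Set (E d)} {u₁ u₂ t₁ t₂ : E d → ℝ}
    {D₁ D₂ : E d → E d} (hu₁ : MemLp u₁ 2 (bulkMeasure Ω)) (hu₂ : MemLp u₂ 2 (bulkMeasure Ω))
    (hD₁ : MemLp D₁ 2 (bulkMeasure Ω)) (hD₂ : MemLp D₂ 2 (bulkMeasure Ω))
    (h₁ : HasTrace Ω u₁ D₁ t₁) (h₂ : HasTrace Ω u₂ D₂ t₂) :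
    HasTrace Ω (u₁ - u₂) (D₁ - D₂) (t₁ - t₂) := by
  obtain ⟨ht₁, φ, hφ, a₁, b₁, c₁⟩ := h₁
  obtain ⟨ht₂, ψ, hψ, a₂, b₂, c₂⟩ := h₂
  have hc : ∀ {φ : E d → ℝ} {μ : Measure (E d)}, IsTest φ → AEStronglyMeasurable φ μ :=
    fun h => h.1.continuous.aestronglyMeasurable
  have hcg : ∀ {φ : E d → ℝ} {μ : Measure (E d)}, IsTest φ →
      AEStronglyMeasurable (gradient φ) μ := fun h => h.continuous_gradient.aestronglyMeasurable
  refine ⟨ht₁.sub ht₂, fun k x => φ k x - ψ k x, fun k => (hφ k).sub (hψ k), ?_, ?_, ?_⟩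
  · exact tendsto_eLpNorm_sub_sub (fun k => hc (hφ k)) (fun k => hc (hψ k)) hu₁.1 hu₂.1 a₁ a₂
  · have := tendsto_eLpNorm_sub_sub (fun k => hcg (hφ k)) (fun k => hcg (hψ k)) hD₁.1 hD₂.1 b₁ b₂
    simpa only [(hφ _).gradient_sub (hψ _), Pi.sub_apply] using this
  · exact tendsto_eLpNorm_sub_sub (fun k => hc (hφ k)) (fun k => hc (hψ k)) ht₁.1 ht₂.1 c₁ c₂

theorem HasSurfaceGradient.sub {Ω : Set (E d)} (hΩ : IsBoundedC2Domain Ω) {v₁ v₂ : E d → ℝ}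
    {D₁ D₂ : E d → E d} (h₁ : HasSurfaceGradient Ω v₁ D₁) (h₂ : HasSurfaceGradient Ω v₂ D₂) :
    HasSurfaceGradient Ω (v₁ - v₂) (D₁ - D₂) := by
  obtain ⟨hv₁, hD₁, φ, hφ, a₁, b₁⟩ := h₁
  obtain ⟨hv₂, hD₂, ψ, hψ, a₂, b₂⟩ := h₂
  refine ⟨hv₁.sub hv₂, hD₁.sub hD₂, fun k x => φ k x - ψ k x, fun k => (hφ k).sub (hψ k), ?_, ?_⟩
  · exact tendsto_eLpNorm_sub_sub (fun k => (hφ k).1.continuous.aestronglyMeasurable)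
      (fun k => (hψ k).1.continuous.aestronglyMeasurable) hv₁.1 hv₂.1 a₁ a₂
  · have := tendsto_eLpNorm_sub_sub (fun k => ((hφ k).memLp_tangentialGradient hΩ).1)
      (fun k => ((hψ k).memLp_tangentialGradient hΩ).1) hD₁.1 hD₂.1 b₁ b₂
    simpa only [(hφ _).tangentialGradient_sub Ω (hψ _), Pi.sub_apply] using this

/-! ### Green's formulas -/

/-- Integration by parts for functions with traces, from the Gauss-Green formula for products of
the approximating smooth functions. -/
theorem HasTrace.integral_mul_add {Ω : Set (E d)} (hΩ : IsBoundedC2Domain Ω) {u v s t : E d → ℝ}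
    {Du Dv : E d → E d} (hu : MemLp u 2 (bulkMeasure Ω)) (hv : MemLp v 2 (bulkMeasure Ω))
    (hDu : MemLp Du 2 (bulkMeasure Ω)) (hDv : MemLp Dv 2 (bulkMeasure Ω))
    (hus : HasTrace Ω u Du s) (hvt : HasTrace Ω v Dv t) (i : Fin d) :
    ∫ x, Dv x i * u x ∂bulkMeasure Ω + ∫ x, Du x i * v x ∂bulkMeasure Ω
      = ∫ x, t x * outwardNormal Ω x i * s x ∂surfaceMeasure Ω := by
  have := hΩ.isFiniteMeasure_bulkMeasure
  have := hΩ.isFiniteMeasure_surfaceMeasure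
  obtain ⟨hs, φ, hφ, a₁, b₁, c₁⟩ := hus
  obtain ⟨ht, ψ, hψ, a₂, b₂, c₂⟩ := hvt
  have hcoord : ∀ {D : E d → E d}, MemLp D 2 (bulkMeasure Ω) →
      MemLp (fun x => D x i) 2 (bulkMeasure Ω) := fun h => h.eval_piLp i
  have hgi : ∀ {D : E d → E d} {φ : ℕ → E d → ℝ}, Tendsto (fun k => eLpNorm
      (fun x => gradient (φ k) x - D x) 2 (bulkMeasure Ω)) atTop (𝓝 0) →
      Tendsto (fun k => eLpNorm (fun x => gradient (φ k) x i - D x i) 2 (bulkMeasure Ω))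
        atTop (𝓝 0) := fun {D φ} h =>
    tendsto_eLpNorm_of_norm_le (fun k x => by
      simpa using PiLp.norm_apply_le (gradient (φ k) x - D x) i) h
  have hni : ∀ x, ‖outwardNormal Ω x i‖ ≤ 1 := fun x =>
    (PiLp.norm_apply_le _ i).trans (norm_outwardNormal_le_one Ω x)
  have hnm : AEStronglyMeasurable (fun x => outwardNormal Ω x i) (surfaceMeasure Ω) :=
    (EuclideanSpace.proj (𝕜 := ℝ) i).continuous.comp_aestronglyMeasurable
      hΩ.aestronglyMeasurable_outwardNormal
  have hmn : ∀ {w : E d → ℝ}, MemLp w 2 (surfaceMeasure Ω) →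
      MemLp (fun x => w x * outwardNormal Ω x i) 2 (surfaceMeasure Ω) := fun h =>
    h.of_le (h.1.mul hnm) (Eventually.of_forall fun x => by
      rw [norm_mul]; exact mul_le_of_le_one_right (norm_nonneg _) (hni x))
  have l1 := tendsto_integral_mul_of_tendsto_eLpNorm
    (fun k => hcoord ((hψ k).memLp_gradient _)) (fun k => (hφ k).memLp _) (hcoord hDv) hu
    (hgi b₂) a₁
  have l2 := tendsto_integral_mul_of_tendsto_eLpNorm
    (fun k => hcoord ((hφ k).memLp_gradient _)) (fun k => (hψ k).memLp _) (hcoord hDu) hv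
    (hgi b₁) a₂
  have l3 := tendsto_integral_mul_of_tendsto_eLpNorm
    (fun k => hmn ((hψ k).memLp _)) (fun k => (hφ k).memLp _) (hmn ht) hs
    (tendsto_eLpNorm_of_norm_le (fun k x => by
      rw [← sub_mul, norm_mul]; exact mul_le_of_le_one_right (norm_nonneg _) (hni x)) c₂) c₁
  refine tendsto_nhds_unique (l1.add l2) (l3.congr fun k => ?_)
  set e : E d := EuclideanSpace.single i (1 : ℝ)
  have hgrad : ∀ (f : E d → ℝ) (x : E d), gradient f x i = fderiv ℝ f x e := fun f x => by
    rw [← inner_gradient_left, EuclideanSpace.inner_single_right]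
    simp
  have hprod : ∀ x, fderiv ℝ (fun x => ψ k x * φ k x) x e
      = gradient (ψ k) x i * φ k x + gradient (φ k) x i * ψ k x := by
    intro x
    rw [fderiv_fun_mul ((hψ k).contDiff_one.differentiable one_ne_zero x)
      ((hφ k).contDiff_one.differentiable one_ne_zero x), hgrad, hgrad]
    simp only [add_apply, smul_apply, smul_eq_mul]
    ring
  have hGG := hΩ.gaussGreen ((hψ k).contDiff_one.mul (hφ k).contDiff_one) (hφ k).2.mul_left e
  simp only [hprod] at hGG
  rw [integral_add (integrable_fun_mul_of_memLp (hcoord ((hψ k).memLp_gradient _)) ((hφ k).memLp _))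
    (integrable_fun_mul_of_memLp (hcoord ((hφ k).memLp_gradient _)) ((hψ k).memLp _))] at hGG
  rw [hGG]
  refine integral_congr_ae (Eventually.of_forall fun x => ?_)
  simp only [e, EuclideanSpace.inner_single_right]
  simp only [conj_trivial, one_mul]
  ring

theorem inner_eq_sum (x y : E d) : (inner ℝ x y : ℝ) = ∑ i, x i * y i := by
  rw [PiLp.inner_apply]
  exact Finset.sum_congr rfl fun i _ => by simp [mul_comm]

theorem memLp_inner_outwardNormal {Ω : Set (E d)} (hΩ : IsBoundedC2Domain Ω) {D : E d → E d}
    (hD : ∀ i, MemLp (fun x => D x i) 2 (surfaceMeasure Ω)) :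
    MemLp (fun x => (inner ℝ (D x) (outwardNormal Ω x) : ℝ)) 2 (surfaceMeasure Ω) := by
  have hD' : MemLp D 2 (surfaceMeasure Ω) := MemLp.of_eval_piLp hD
  refine hD'.of_le (hD'.1.inner hΩ.aestronglyMeasurable_outwardNormal)
    (Eventually.of_forall fun x => ?_)
  exact (norm_inner_le_norm _ _).trans
    (mul_le_of_le_one_right (norm_nonneg _) (norm_outwardNormal_le_one Ω x))

/-- **Green's formula** in `H²(Ω)`. -/
theorem green_formula {Ω : Set (E d)} (hΩ : IsBoundedC2Domain Ω) {u s : E d → ℝ}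
    {Du T : E d → E d} {H : Fin d → E d → E d} (hu : MemLp u 2 (bulkMeasure Ω))
    (hDu : MemLp Du 2 (bulkMeasure Ω)) (hH : ∀ i, MemLp (H i) 2 (bulkMeasure Ω))
    (hus : HasTrace Ω u Du s) (hT : ∀ i, HasTrace Ω (fun x => Du x i) (H i) fun x => T x i) :
    ∫ x, (∑ i, H i x i) * u x ∂bulkMeasure Ω + ∫ x, ‖Du x‖ ^ 2 ∂bulkMeasure Ω
      = ∫ x, inner ℝ (T x) (outwardNormal Ω x) * s x ∂surfaceMeasure Ω := by
  have hDi : ∀ i, MemLp (fun x => Du x i) 2 (bulkMeasure Ω) := fun i => hDu.eval_piLp i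
  have hHi : ∀ i, MemLp (fun x => H i x i) 2 (bulkMeasure Ω) := fun i => (hH i).eval_piLp i
  have hni : ∀ i, MemLp (fun x => T x i * outwardNormal Ω x i) 2 (surfaceMeasure Ω) := by
    intro i
    have hnm : AEStronglyMeasurable (fun x => outwardNormal Ω x i) (surfaceMeasure Ω) :=
      (EuclideanSpace.proj (𝕜 := ℝ) i).continuous.comp_aestronglyMeasurable
        hΩ.aestronglyMeasurable_outwardNormal
    refine (hT i).1.of_le ((hT i).1.1.mul hnm) (Eventually.of_forall fun x => ?_)
    rw [norm_mul]
    exact mul_le_of_le_one_right (norm_nonneg _)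
      ((PiLp.norm_apply_le _ i).trans (norm_outwardNormal_le_one Ω x))
  have hnorm : ∀ x, ‖Du x‖ ^ 2 = ∑ i, Du x i * Du x i := fun x => by
    rw [← real_inner_self_eq_norm_sq, inner_eq_sum]
  simp only [inner_eq_sum, hnorm, Finset.sum_mul]
  rw [integral_finsetSum _ fun i _ => integrable_fun_mul_of_memLp (hHi i) hu,
    integral_finsetSum _ fun i _ => integrable_fun_mul_of_memLp (hDi i) (hDi i),
    integral_finsetSum _ fun i _ => integrable_fun_mul_of_memLp (hni i) hus.1,
    ← Finset.sum_add_distrib]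
  exact Finset.sum_congr rfl fun i _ =>
    hus.integral_mul_add hΩ hu (hDi i) hDu (hH i) (hT i) i

/-- Green's formula on the boundary, for differences of functions with square integrable
Laplace-Beltrami operator. -/
theorem HasLaplaceBeltrami.integral_sub_mul_sub {Ω : Set (E d)} (hΩ : IsBoundedC2Domain Ω)
    {v₁ v₂ : SurfaceH2 Ω} {L₁ L₂ : E d → ℝ} (h₁ : HasLaplaceBeltrami v₁ L₁)
    (h₂ : HasLaplaceBeltrami v₂ L₂) :
    ∫ x, (L₁ x - L₂ x) * (v₁.val x - v₂.val x) ∂surfaceMeasure Ω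
      = - ∫ x, ‖v₁.grad x - v₂.grad x‖ ^ 2 ∂surfaceMeasure Ω := by
  have := hΩ.isFiniteMeasure_surfaceMeasure
  obtain ⟨hv, hD, φ, hφ, a, b⟩ := v₁.surf_grad.sub hΩ v₂.surf_grad
  have l1 := tendsto_integral_mul_of_tendsto_eLpNorm (fun _ => h₁.1.sub h₂.1)
    (fun k => (hφ k).memLp _) (h₁.1.sub h₂.1) hv (by simp) a
  have l2 := tendsto_integral_inner_of_tendsto_eLpNorm (fun _ => hD)
    (fun k => (hφ k).memLp_tangentialGradient hΩ) hD hD (by simp) b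
  simp only [Pi.sub_apply, real_inner_self_eq_norm_sq] at l1 l2
  refine tendsto_nhds_unique l1 (l2.neg.congr fun k => ?_)
  have hI : ∀ v : SurfaceH2 Ω, Integrable (fun x =>
      (inner ℝ (v.grad x) (tangentialGradient Ω (φ k) x) : ℝ)) (surfaceMeasure Ω) := fun v =>
    integrable_inner_of_memLp v.surf_grad.2.1 ((hφ k).memLp_tangentialGradient hΩ)
  simp only [sub_mul, inner_sub_left]
  rw [integral_sub (integrable_fun_mul_of_memLp h₁.1 ((hφ k).memLp _))
    (integrable_fun_mul_of_memLp h₂.1 ((hφ k).memLp _)), integral_sub (hI v₁) (hI v₂),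
    h₁.2 _ (hφ k), h₂.2 _ (hφ k)]
  ring

/-! ### Strong monotonicity and the energy estimate -/

theorem IsSingularPotential.mul_sq_sub_le {Θ : ℝ} {F : ℝ → ℝ} (hF : IsSingularPotential Θ F)
    {a b : ℝ} (ha : |a| < 1) (hb : |b| < 1) :
    Θ * (a - b) ^ 2 ≤ (deriv F a - deriv F b) * (a - b) := by
  wlog hab : b ≤ a generalizing a b
  · have := this hb ha (not_le.1 hab).le
    linarith
  have hd : DifferentiableOn ℝ (deriv F) (Ioo (-1) 1) :=
    ((contDiffOn_succ_iff_deriv_of_isOpen (n := 1) isOpen_Ioo).1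
      (by simpa [one_add_one_eq_two] using hF.contDiffOn)).2.2.differentiableOn one_ne_zero
  have h := (convex_Ioo (-1 : ℝ) 1).mul_sub_le_image_sub_of_le_deriv hd.continuousOn
    (by rwa [isOpen_Ioo.interior_eq]) (by rw [isOpen_Ioo.interior_eq]; exact hF.convex)
    b (abs_lt.1 hb) a (abs_lt.1 ha) hab
  nlinarith

theorem integral_sq_add_norm_sq {X F : Type*} [MeasurableSpace X] {μ : Measure X}
    [NormedAddCommGroup F] {u : X → ℝ} {D : X → F} (hu : MemLp u 2 μ) (hD : MemLp D 2 μ) :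
    ∫ x, u x ^ 2 + ‖D x‖ ^ 2 ∂μ = ∫ x, u x ^ 2 ∂μ + ∫ x, ‖D x‖ ^ 2 ∂μ :=
  integral_add hu.integrable_sq hD.norm.integrable_sq

/-- Young's inequality, integrated. -/
theorem integral_mul_le_young {X : Type*} [MeasurableSpace X] {μ : Measure X} {f u : X → ℝ}
    (hf : MemLp f 2 μ) (hu : MemLp u 2 μ) {c : ℝ} (hc : 0 < c) :
    ∫ x, f x * u x ∂μ ≤ (2 * c)⁻¹ * ∫ x, f x ^ 2 ∂μ + c / 2 * ∫ x, u x ^ 2 ∂μ := by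
  rw [← integral_const_mul, ← integral_const_mul,
    ← integral_add (hf.integrable_sq.const_mul _) (hu.integrable_sq.const_mul _)]
  refine integral_mono (integrable_fun_mul_of_memLp hf hu)
    ((hf.integrable_sq.const_mul _).add (hu.integrable_sq.const_mul _)) fun x => ?_
  have : (2 * c)⁻¹ * f x ^ 2 + c / 2 * u x ^ 2 - f x * u x
      = (2 * c)⁻¹ * (f x - c * u x) ^ 2 := by
    field_simp; ring
  have h2 : 0 ≤ (2 * c)⁻¹ * (f x - c * u x) ^ 2 := by positivity
  show f x * u x ≤ (2 * c)⁻¹ * f x ^ 2 + c / 2 * u x ^ 2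
  linarith

/-- Testing the difference of two bulk equations with the difference `u` of the solutions; `N` is
the difference of the nonlinear terms. -/
theorem integral_norm_sq_le_of_eq {X F : Type*} [MeasurableSpace X] {μ : Measure X}
    [NormedAddCommGroup F] {u f N A : X → ℝ} {D : X → F} {Θ B : ℝ} (hu : MemLp u 2 μ)
    (hf : MemLp f 2 μ) (hN : MemLp N 2 μ) (hmono : ∀ᵐ x ∂μ, Θ * u x ^ 2 ≤ N x * u x)
    (heq : ∀ᵐ x ∂μ, A x = N x - f x)
    (hgreen : ∫ x, A x * u x ∂μ + ∫ x, ‖D x‖ ^ 2 ∂μ = B) :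
    ∫ x, ‖D x‖ ^ 2 ∂μ + Θ * ∫ x, u x ^ 2 ∂μ ≤ ∫ x, f x * u x ∂μ + B := by
  have h1 : ∫ x, A x * u x ∂μ = ∫ x, N x * u x ∂μ - ∫ x, f x * u x ∂μ := by
    rw [← integral_sub (integrable_fun_mul_of_memLp hN hu) (integrable_fun_mul_of_memLp hf hu)]
    refine integral_congr_ae ?_
    filter_upwards [heq] with x hx
    rw [hx, sub_mul]
  have h2 : Θ * ∫ x, u x ^ 2 ∂μ ≤ ∫ x, N x * u x ∂μ := by
    rw [← integral_const_mul]
    exact integral_mono_ae (hu.integrable_sq.const_mul _) (integrable_fun_mul_of_memLp hN hu) hmono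
  linarith

/-- The energy estimate for the difference of two solutions. -/
theorem IsSolution.energy_le {Ω : Set (E d)} (hΩ : IsBoundedC2Domain Ω) {K α ΘΩ ΘΓ : ℝ}
    (hK : 0 ≤ K) {F G : ℝ → ℝ} (hF : IsSingularPotential ΘΩ F) (hG : IsSingularPotential ΘΓ G)
    {f₁ g₁ f₂ g₂ : E d → ℝ} (hf₁ : MemLp f₁ 2 (bulkMeasure Ω))
    (hg₁ : MemLp g₁ 2 (surfaceMeasure Ω)) (hf₂ : MemLp f₂ 2 (bulkMeasure Ω))
    (hg₂ : MemLp g₂ 2 (surfaceMeasure Ω)) {u₁ u₂ : BulkH2 Ω} {v₁ v₂ : SurfaceH2 Ω}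
    (h₁ : IsSolution Ω K α F G f₁ g₁ u₁ v₁) (h₂ : IsSolution Ω K α F G f₂ g₂ u₂ v₂) :
    (∫ x, ‖(u₁.grad - u₂.grad) x‖ ^ 2 ∂bulkMeasure Ω
        + ΘΩ * ∫ x, (u₁.val - u₂.val) x ^ 2 ∂bulkMeasure Ω)
      + (∫ x, ‖(v₁.grad - v₂.grad) x‖ ^ 2 ∂surfaceMeasure Ω
        + ΘΓ * ∫ x, (v₁.val - v₂.val) x ^ 2 ∂surfaceMeasure Ω)
    ≤ ∫ x, (f₁ - f₂) x * (u₁.val - u₂.val) x ∂bulkMeasure Ω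
      + ∫ x, (g₁ - g₂) x * (v₁.val - v₂.val) x ∂surfaceMeasure Ω := by
  obtain ⟨s₁, T₁, L₁, hs₁, hT₁, hL₁, hb₁, hr₁⟩ := h₁.boundary_eq
  obtain ⟨s₂, T₂, L₂, hs₂, hT₂, hL₂, hb₂, hr₂⟩ := h₂.boundary_eq
  have hu := u₁.memLp_val.sub u₂.memLp_val
  have hv := v₁.surf_grad.1.sub v₂.surf_grad.1
  have hs := hs₁.sub u₁.memLp_val u₂.memLp_val u₁.memLp_grad u₂.memLp_grad hs₂
  have hT : ∀ i, HasTrace Ω (fun x => (u₁.grad - u₂.grad) x i) (u₁.hess i - u₂.hess i)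
      (fun x => (T₁ - T₂) x i) := fun i =>
    (hT₁ i).sub (u₁.memLp_grad.eval_piLp i) (u₂.memLp_grad.eval_piLp i) (u₁.memLp_hess i)
      (u₂.memLp_hess i) (hT₂ i)
  set q : E d → ℝ := fun x => inner ℝ ((T₁ - T₂) x) (outwardNormal Ω x) with hq
  have hqL : MemLp q 2 (surfaceMeasure Ω) := memLp_inner_outwardNormal hΩ fun i => (hT i).1
  have hqsub : ∀ x, q x = inner ℝ (T₁ x) (outwardNormal Ω x) - inner ℝ (T₂ x) (outwardNormal Ω x) :=
    fun x => inner_sub_left _ _ _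
  have hbulk := integral_norm_sq_le_of_eq (Θ := ΘΩ) hu (hf₁.sub hf₂)
    (h₁.memLp_bulk.sub h₂.memLp_bulk)
    (by
      filter_upwards [h₁.bulk_range, h₂.bulk_range] with x ha hb using hF.mul_sq_sub_le ha hb)
    (by
      filter_upwards [h₁.bulk_eq, h₂.bulk_eq] with x ha hb
      simp only [BulkH2.laplacian] at ha hb
      simp only [Pi.sub_apply, PiLp.sub_apply, Finset.sum_sub_distrib]
      linarith)
    (green_formula hΩ hu (u₁.memLp_grad.sub u₂.memLp_grad)
      (fun i => (u₁.memLp_hess i).sub (u₂.memLp_hess i)) hs hT)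
  have hsurf := integral_norm_sq_le_of_eq (Θ := ΘΓ) (D := v₁.grad - v₂.grad) hv
    ((hg₁.sub hg₂).sub (hqL.const_mul α)) (h₁.memLp_surface.sub h₂.memLp_surface)
    (by
      filter_upwards [h₁.surface_range, h₂.surface_range] with x ha hb
        using hG.mul_sq_sub_le ha hb)
    (A := fun x => L₁ x - L₂ x)
    (by
      filter_upwards [hb₁, hb₂] with x ha hb
      simp only [Pi.sub_apply, hqsub]
      linarith)
    (B := 0)
    (by
      have := hL₁.integral_sub_mul_sub hΩ hL₂
      simp only [Pi.sub_apply]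
      rw [this]
      ring)
  -- the boundary terms add up to `-K ∫ |∂ₙu|² ≤ 0`
  have hcoup : ∫ x, q x * (s₁ - s₂) x ∂surfaceMeasure Ω
      ≤ α * ∫ x, q x * (v₁.val - v₂.val) x ∂surfaceMeasure Ω := by
    rw [← integral_const_mul]
    refine integral_mono_ae (integrable_fun_mul_of_memLp hqL hs.1)
      ((integrable_fun_mul_of_memLp hqL hv).const_mul α) ?_
    filter_upwards [hr₁, hr₂] with x ha hb
    have h1 : K * q x = α * (v₁.val - v₂.val) x - (s₁ - s₂) x := by
      simp only [hqsub, Pi.sub_apply]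
      linarith
    have h2 : 0 ≤ K * q x ^ 2 := by positivity
    have h3 : K * q x ^ 2
        = α * (q x * (v₁.val - v₂.val) x) - q x * (s₁ - s₂) x := by
      rw [sq, ← mul_assoc, h1]; ring
    show q x * (s₁ - s₂) x ≤ α * (q x * (v₁.val - v₂.val) x)
    linarith
  have hsplit : ∫ x, ((g₁ - g₂) - fun x => α * q x) x * (v₁.val - v₂.val) x ∂surfaceMeasure Ω
      = ∫ x, (g₁ - g₂) x * (v₁.val - v₂.val) x ∂surfaceMeasure Ω
        - α * ∫ x, q x * (v₁.val - v₂.val) x ∂surfaceMeasure Ω := by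
    rw [← integral_const_mul, ← integral_sub (integrable_fun_mul_of_memLp (hg₁.sub hg₂) hv)
      ((integrable_fun_mul_of_memLp hqL hv).const_mul α)]
    refine integral_congr_ae (Eventually.of_forall fun x => ?_)
    simp only [Pi.sub_apply]
    ring
  linarith

/-- Continuous dependence, for every `c` below the coercivity constants `1`, `ΘΩ` and `ΘΓ` of the
energy. -/
theorem IsSolution.normH1_sub_le {Ω : Set (E d)} (hΩ : IsBoundedC2Domain Ω) {K α ΘΩ ΘΓ c : ℝ}
    (hK : 0 ≤ K) (hc : 0 < c) (hc1 : c ≤ 1) (hcΩ : c ≤ ΘΩ) (hcΓ : c ≤ ΘΓ) {F G : ℝ → ℝ}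
    (hF : IsSingularPotential ΘΩ F) (hG : IsSingularPotential ΘΓ G)
    {f₁ g₁ f₂ g₂ : E d → ℝ} (hf₁ : MemLp f₁ 2 (bulkMeasure Ω))
    (hg₁ : MemLp g₁ 2 (surfaceMeasure Ω)) (hf₂ : MemLp f₂ 2 (bulkMeasure Ω))
    (hg₂ : MemLp g₂ 2 (surfaceMeasure Ω)) {u₁ u₂ : BulkH2 Ω} {v₁ v₂ : SurfaceH2 Ω}
    (h₁ : IsSolution Ω K α F G f₁ g₁ u₁ v₁) (h₂ : IsSolution Ω K α F G f₂ g₂ u₂ v₂) :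
    normH1 Ω (u₁.val - u₂.val) (u₁.grad - u₂.grad) (v₁.val - v₂.val) (v₁.grad - v₂.grad)
      ≤ c⁻¹ * normL2 Ω (f₁ - f₂) (g₁ - g₂) := by
  have hu := u₁.memLp_val.sub u₂.memLp_val
  have hv := v₁.surf_grad.1.sub v₂.surf_grad.1
  have hE := h₁.energy_le hΩ hK hF hG hf₁ hg₁ hf₂ hg₂ h₂
  have hY1 := integral_mul_le_young (hf₁.sub hf₂) hu hc
  have hY2 := integral_mul_le_young (hg₁.sub hg₂) hv hc
  rw [normH1, normL2, integral_sq_add_norm_sq hu (u₁.memLp_grad.sub u₂.memLp_grad),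
    integral_sq_add_norm_sq hv (v₁.surf_grad.2.1.sub v₂.surf_grad.2.1)]
  set a := ∫ x, (u₁.val - u₂.val) x ^ 2 ∂bulkMeasure Ω
  set b := ∫ x, ‖(u₁.grad - u₂.grad) x‖ ^ 2 ∂bulkMeasure Ω
  set a' := ∫ x, (v₁.val - v₂.val) x ^ 2 ∂surfaceMeasure Ω
  set b' := ∫ x, ‖(v₁.grad - v₂.grad) x‖ ^ 2 ∂surfaceMeasure Ω
  set p := ∫ x, (f₁ - f₂) x ^ 2 ∂bulkMeasure Ω
  set p' := ∫ x, (g₁ - g₂) x ^ 2 ∂surfaceMeasure Ω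
  have ha : 0 ≤ a := integral_nonneg fun x => sq_nonneg _
  have ha' : 0 ≤ a' := integral_nonneg fun x => sq_nonneg _
  have hb : 0 ≤ b := integral_nonneg fun x => sq_nonneg _
  have hb' : 0 ≤ b' := integral_nonneg fun x => sq_nonneg _
  have key : c / 2 * (a + b + (a' + b')) ≤ (2 * c)⁻¹ * (p + p') := by
    nlinarith [mul_le_mul_of_nonneg_right hcΩ ha, mul_le_mul_of_nonneg_right hcΓ ha',
      mul_le_mul_of_nonneg_right hc1 hb, mul_le_mul_of_nonneg_right hc1 hb', mul_nonneg hc.le hb,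
      mul_nonneg hc.le hb']
  refine Real.sqrt_le_iff.2 ⟨by positivity, ?_⟩
  have hp : 0 ≤ p + p' :=
    add_nonneg (integral_nonneg fun x => sq_nonneg _) (integral_nonneg fun x => sq_nonneg _)
  rw [mul_pow, Real.sq_sqrt hp]
  have h2 := mul_le_mul_of_nonneg_left key (show 0 ≤ 2 * c⁻¹ by positivity)
  calc a + b + (a' + b') = 2 * c⁻¹ * (c / 2 * (a + b + (a' + b'))) := by field_simp
    _ ≤ _ := h2
    _ = _ := by field_simp

theorem ae_eq_of_integral_sq_sub_eq_zero {X : Type*} [MeasurableSpace X] {μ : Measure X}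
    {u v : X → ℝ} (h : MemLp (u - v) 2 μ) (h0 : ∫ x, (u - v) x ^ 2 ∂μ = 0) : u =ᵐ[μ] v := by
  filter_upwards [(integral_eq_zero_iff_of_nonneg (fun x => sq_nonneg _) h.integrable_sq).1 h0]
    with x hx
  exact sub_eq_zero.1 (pow_eq_zero_iff two_ne_zero |>.1 hx)

/-- A pair vanishing in the `H¹` norm vanishes almost everywhere. -/
theorem ae_eq_of_normH1_sub_nonpos {Ω : Set (E d)} {u₁ u₂ : BulkH2 Ω} {v₁ v₂ : SurfaceH2 Ω}
    (h : normH1 Ω (u₁.val - u₂.val) (u₁.grad - u₂.grad) (v₁.val - v₂.val) (v₁.grad - v₂.grad)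
      ≤ 0) : u₁.val =ᵐ[bulkMeasure Ω] u₂.val ∧ v₁.val =ᵐ[surfaceMeasure Ω] v₂.val := by
  have hu := u₁.memLp_val.sub u₂.memLp_val
  have hv := v₁.surf_grad.1.sub v₂.surf_grad.1
  rw [normH1, integral_sq_add_norm_sq hu (u₁.memLp_grad.sub u₂.memLp_grad),
    integral_sq_add_norm_sq hv (v₁.surf_grad.2.1.sub v₂.surf_grad.2.1), Real.sqrt_le_iff] at h
  have ha : 0 ≤ ∫ x, (u₁.val - u₂.val) x ^ 2 ∂bulkMeasure Ω :=
    integral_nonneg fun x => sq_nonneg _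
  have ha' : 0 ≤ ∫ x, (v₁.val - v₂.val) x ^ 2 ∂surfaceMeasure Ω :=
    integral_nonneg fun x => sq_nonneg _
  have hb : 0 ≤ ∫ x, ‖(u₁.grad - u₂.grad) x‖ ^ 2 ∂bulkMeasure Ω :=
    integral_nonneg fun x => sq_nonneg _
  have hb' : 0 ≤ ∫ x, ‖(v₁.grad - v₂.grad) x‖ ^ 2 ∂surfaceMeasure Ω :=
    integral_nonneg fun x => sq_nonneg _
  have h0 := h.2
  exact ⟨ae_eq_of_integral_sq_sub_eq_zero hu (by linarith),
    ae_eq_of_integral_sq_sub_eq_zero hv (by linarith)⟩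

end BulkSurface

end

theorem proposition5p2 (d : ℕ) (hd : d = 2 ∨ d = 3)
    (Ω : Set (BulkSurface.E d)) (hΩ : BulkSurface.IsBoundedC2Domain Ω)
    (K : ℝ) (hK : 0 ≤ K) (α : ℝ) (hα : -1 ≤ α ∧ α ≤ 1)
    (ΘΩ ΘΓ : ℝ) (hΘΩ : 0 < ΘΩ) (hΘΓ : 0 < ΘΓ) :
    -- continuous dependence, with a constant depending only on `Ω`, `K`, `α`, `ΘΩ` and `ΘΓ`
    (∃ C > 0, ∀ F G : ℝ → ℝ,
      BulkSurface.IsSingularPotential ΘΩ F → BulkSurface.IsSingularPotential ΘΓ G →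
      BulkSurface.Dominates α F G →
      ∀ f₁ g₁ f₂ g₂ : BulkSurface.E d → ℝ,
        MemLp f₁ 2 (BulkSurface.bulkMeasure Ω) → MemLp g₁ 2 (BulkSurface.surfaceMeasure Ω) →
        MemLp f₂ 2 (BulkSurface.bulkMeasure Ω) → MemLp g₂ 2 (BulkSurface.surfaceMeasure Ω) →
      ∀ (u₁ u₂ : BulkSurface.BulkH2 Ω) (v₁ v₂ : BulkSurface.SurfaceH2 Ω),
        BulkSurface.IsSolution Ω K α F G f₁ g₁ u₁ v₁ →
        BulkSurface.IsSolution Ω K α F G f₂ g₂ u₂ v₂ →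
        BulkSurface.normH1 Ω (u₁.val - u₂.val) (u₁.grad - u₂.grad)
            (v₁.val - v₂.val) (v₁.grad - v₂.grad)
          ≤ C * BulkSurface.normL2 Ω (f₁ - f₂) (g₁ - g₂)) ∧
    -- uniqueness of the solution
    (∀ F G : ℝ → ℝ,
      BulkSurface.IsSingularPotential ΘΩ F → BulkSurface.IsSingularPotential ΘΓ G →
      BulkSurface.Dominates α F G →
      ∀ f g : BulkSurface.E d → ℝ,
        MemLp f 2 (BulkSurface.bulkMeasure Ω) → MemLp g 2 (BulkSurface.surfaceMeasure Ω) →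
      ∀ (u₁ u₂ : BulkSurface.BulkH2 Ω) (v₁ v₂ : BulkSurface.SurfaceH2 Ω),
        BulkSurface.IsSolution Ω K α F G f g u₁ v₁ →
        BulkSurface.IsSolution Ω K α F G f g u₂ v₂ →
        u₁.val =ᵐ[BulkSurface.bulkMeasure Ω] u₂.val ∧
        v₁.val =ᵐ[BulkSurface.surfaceMeasure Ω] v₂.val) := by
  set c := min 1 (min ΘΩ ΘΓ) with hc
  have hc0 : 0 < c := lt_min one_pos (lt_min hΘΩ hΘΓ)
  have hcΩ : c ≤ ΘΩ := (min_le_right _ _).trans (min_le_left _ _)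
  have hcΓ : c ≤ ΘΓ := (min_le_right _ _).trans (min_le_right _ _)
  refine ⟨⟨c⁻¹, inv_pos.2 hc0, ?_⟩, ?_⟩
  · intro F G hF hG _ f₁ g₁ f₂ g₂ hf₁ hg₁ hf₂ hg₂ u₁ u₂ v₁ v₂ h₁ h₂
    exact h₁.normH1_sub_le hΩ hK hc0 (min_le_left _ _) hcΩ hcΓ hF hG hf₁ hg₁ hf₂ hg₂ h₂
  · intro F G hF hG _ f g hf hg u₁ u₂ v₁ v₂ h₁ h₂
    refine BulkSurface.ae_eq_of_normH1_sub_nonpos ?_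
    have h := h₁.normH1_sub_le hΩ hK hc0 (min_le_left _ _) hcΩ hcΓ hF hG hf hg hf hg h₂
    simpa [BulkSurface.normL2] using h
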